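/- Let $a>0$, let $\Omega:=\mathbb{R}\times(-a,a)$, and let all function spaces be real. Let $-\Delta_0$ be the self-adjoint operator in $L^2(\Omega)$ associated with the quadratic form $\psi\mapsto\|\nabla\psi\|_{L^2(\Omega)}^2$ with domain $\{\psi\in H^1(\Omega) : \psi=0 \text{ on } \mathbb{R}\times\{-a\}\}$ (in the sense of traces), i.e. the Laplacian with Dirichlet condition on $\mathbb{R}\times\{-a\}$ and Neumann condition on $\mathbb{R}\times\{a\}$. Put $E_1:=\left(\frac{\pi}{4a}\right)^2$, and let $L^2(\Omega,K)$ be the weighted space with norm $\left(\int_\Omega |u(x)|^2 K(x)\,dx\right)^{1/2}$, where $K(x):=e^{x_1^2/4}$; since $K\ge 1$, $L^2(\Omega,K)\subset L^2(\Omega)$. Then $\Delta_0+E_1$ generates a strongly continuous semigroup $S_0(t)=e^{(\Delta_0+E_1)t}$, $t\ge0$, on $L^2(\Omega)$, and there exists a constant $C>0$ (depending only on $a$) such that for every $t\ge 1$, $$ C^{-1}\,t^{-1/4}\;\le\;\|S_0(t)\|_{L^2(\Omega,K)\to L^2(\Omega)}\;\le\; C\,t^{-1/4}. $$ -/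

import Mathlib

open MeasureTheory Filter Set
open scoped Topology ContDiff

noncomputable section

namespace UntwistedStrip

/-- The strip `Ω = ℝ × (-a, a)`. -/
def strip (a : ℝ) : Set (ℝ × ℝ) := univ ×ˢ Ioo (-a) a

/-- Lebesgue measure on the strip. -/
def stripMeasure (a : ℝ) : Measure (ℝ × ℝ) := volume.restrict (strip a)

/-- The real Hilbert space `L²(Ω)`. -/
abbrev L2 (a : ℝ) : Type := Lp ℝ 2 (stripMeasure a)

/-- The weight `K(x) = exp (x₁² / 4)`. -/
def weight (x : ℝ × ℝ) : ℝ := Real.exp (x.1 ^ 2 / 4)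

/-- The measure `K(x) dx` on the strip. -/
def weightedMeasure (a : ℝ) : Measure (ℝ × ℝ) :=
  (stripMeasure a).withDensity fun x => ENNReal.ofReal (weight x)

/-- The weighted space `L²(Ω, K)`, with norm `(∫_Ω |u|² K dx)^{1/2}`. -/
abbrev L2K (a : ℝ) : Type := Lp ℝ 2 (weightedMeasure a)

theorem stripMeasure_le_weightedMeasure (a : ℝ) : stripMeasure a ≤ weightedMeasure a := by
  have h : (stripMeasure a).withDensity 1 ≤ weightedMeasure a := by
    refine withDensity_mono (Eventually.of_forall fun x => ?_)
    have hx : (1 : ℝ) ≤ weight x := Real.one_le_exp (by positivity)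
    simpa using ENNReal.ofReal_le_ofReal hx
  simpa using h

theorem memLp_of_mem_L2K {a : ℝ} (u : L2K a) : MemLp u 2 (stripMeasure a) :=
  (Lp.memLp u).mono_measure (stripMeasure_le_weightedMeasure a)

theorem ae_of_ae_weighted {a : ℝ} {p : ℝ × ℝ → Prop} (h : ∀ᵐ x ∂weightedMeasure a, p x) :
    ∀ᵐ x ∂stripMeasure a, p x :=
  ae_mono (stripMeasure_le_weightedMeasure a) h

/-- The inclusion `L²(Ω, K) ⊆ L²(Ω)`, `u ↦ u`, as a bounded linear map (note `K ≥ 1`). -/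
def inclusion (a : ℝ) : L2K a →L[ℝ] L2 a :=
  LinearMap.mkContinuous
    { toFun := fun u => (memLp_of_mem_L2K u).toLp u
      map_add' := fun u v => by
        rw [← MemLp.toLp_add, MemLp.toLp_eq_toLp_iff]
        exact ae_of_ae_weighted (Lp.coeFn_add u v)
      map_smul' := fun c u => by
        rw [RingHom.id_apply, ← MemLp.toLp_const_smul, MemLp.toLp_eq_toLp_iff]
        exact ae_of_ae_weighted (Lp.coeFn_smul c u) }
    1
    (fun u => by
      rw [one_mul]
      change ‖(memLp_of_mem_L2K u).toLp u‖ ≤ ‖u‖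
      rw [Lp.norm_toLp, Lp.norm_def]
      exact ENNReal.toReal_mono (Lp.eLpNorm_ne_top u)
        (eLpNorm_mono_measure _ (stripMeasure_le_weightedMeasure a)))

theorem inclusion_ae_eq {a : ℝ} (u : L2K a) : inclusion a u =ᵐ[stripMeasure a] u :=
  (memLp_of_mem_L2K u).coeFn_toLp

/-- The partial derivative `∂₁ φ`. -/
def partial1 (φ : ℝ × ℝ → ℝ) (x : ℝ × ℝ) : ℝ := fderiv ℝ φ x (1, 0)

/-- The partial derivative `∂₂ φ`. -/
def partial2 (φ : ℝ × ℝ → ℝ) (x : ℝ × ℝ) : ℝ := fderiv ℝ φ x (0, 1)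

/-- `u ∈ H¹(Ω)` with weak gradient `(g₁, g₂)`. -/
def HasWeakGradient {a : ℝ} (u g₁ g₂ : L2 a) : Prop :=
  ∀ φ : ℝ × ℝ → ℝ, ContDiff ℝ ∞ φ → HasCompactSupport φ → tsupport φ ⊆ strip a →
    (∫ x, u x * partial1 φ x ∂stripMeasure a = -∫ x, g₁ x * φ x ∂stripMeasure a) ∧
    (∫ x, u x * partial2 φ x ∂stripMeasure a = -∫ x, g₂ x * φ x ∂stripMeasure a)

/-- The function `u ∈ H¹(Ω)` with weak gradient `(g₁, g₂)` has the trace `τ` on the lower boundary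
line `ℝ × {-a}`: for some sequence `φₙ ∈ C₀^∞(ℝ²)`, `φₙ → u` in `H¹(Ω)` and the restrictions of
`φₙ` to the line converge to `τ` in `L²`. -/
def HasLowerTrace {a : ℝ} (u g₁ g₂ : L2 a) (τ : Lp ℝ 2 (volume : Measure ℝ)) : Prop :=
  ∃ φ : ℕ → ℝ × ℝ → ℝ,
    (∀ n, ContDiff ℝ ∞ (φ n) ∧ HasCompactSupport (φ n)) ∧
    Tendsto (fun n => eLpNorm (fun x => φ n x - u x) 2 (stripMeasure a)) atTop (𝓝 0) ∧
    Tendsto (fun n => eLpNorm (fun x => partial1 (φ n) x - g₁ x) 2 (stripMeasure a)) atTop (𝓝 0) ∧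
    Tendsto (fun n => eLpNorm (fun x => partial2 (φ n) x - g₂ x) 2 (stripMeasure a)) atTop (𝓝 0) ∧
    Tendsto (fun n => eLpNorm (fun s : ℝ => φ n (s, -a) - τ s) 2 volume) atTop (𝓝 0)

/-- `u` belongs to the form domain `{ψ ∈ H¹(Ω) | ψ = 0 on ℝ × {-a}}`, and its weak gradient is
`(g₁, g₂)`. -/
def InFormDomain {a : ℝ} (u g₁ g₂ : L2 a) : Prop :=
  HasWeakGradient u g₁ g₂ ∧ HasLowerTrace u g₁ g₂ 0

/-- The graph of `-Δ₀`, the operator in `L²(Ω)` associated with the quadratic form `‖∇ψ‖²` on the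
form domain: `u` is in the operator domain with `-Δ₀ u = f` iff `u` is in the form domain and
`(∇u, ∇v) = (f, v)` for every `v` in the form domain. -/
def negLaplacianGraph (a : ℝ) : Set (L2 a × L2 a) :=
  {p | ∃ g₁ g₂ : L2 a, InFormDomain p.1 g₁ g₂ ∧
    ∀ v h₁ h₂ : L2 a, InFormDomain v h₁ h₂ →
      inner ℝ g₁ h₁ + inner ℝ g₂ h₂ = inner ℝ p.2 v}

/-- `E₁ = (π / (4a))²`. -/
def E1 (a : ℝ) : ℝ := (Real.pi / (4 * a)) ^ 2

/-- The graph of the shifted Laplacian `Δ₀ + E₁`. -/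
def shiftedLaplacianGraph (a : ℝ) : Set (L2 a × L2 a) :=
  {p | ∃ f : L2 a, (p.1, f) ∈ negLaplacianGraph a ∧ p.2 = -f + E1 a • p.1}

/-- `(T(t))_{t ≥ 0}` is a strongly continuous semigroup whose infinitesimal generator is the
operator with graph `A`. The values of `T` at negative times are irrelevant. -/
structure IsSemigroupGeneratedBy {E : Type*} [NormedAddCommGroup E] [NormedSpace ℝ E]
    (A : Set (E × E)) (T : ℝ → E →L[ℝ] E) : Prop where
  map_zero : T 0 = ContinuousLinearMap.id ℝ E
  map_add : ∀ s t : ℝ, 0 ≤ s → 0 ≤ t → T (s + t) = (T s).comp (T t)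
  continuousOn : ∀ u : E, ContinuousOn (fun t => T t u) (Ici 0)
  generator : ∀ u f : E,
    (u, f) ∈ A ↔ Tendsto (fun t : ℝ => t⁻¹ • (T t u - u)) (𝓝[>] 0) (𝓝 f)

open Classical in
/-- The strongly continuous semigroup `exp (t A)`, `t ≥ 0`, generated by the operator with graph
`A` (a strongly continuous semigroup is determined by its generator); by convention `0` if `A` is
not a generator. -/
def expSemigroup {E : Type*} [NormedAddCommGroup E] [NormedSpace ℝ E]
    (A : Set (E × E)) : ℝ → E →L[ℝ] E :=
  if h : ∃ T : ℝ → E →L[ℝ] E, IsSemigroupGeneratedBy A T then h.choose else 0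

/-- The heat semigroup `S₀(t) = exp (t (Δ₀ + E₁))` on `L²(Ω)`. -/
def S0 (a : ℝ) : ℝ → L2 a →L[ℝ] L2 a := expSemigroup (shiftedLaplacianGraph a)

/-- The operator norm `‖S₀(t)‖` from `L²(Ω, K)` to `L²(Ω)`. -/
def weightedNormS0 (a t : ℝ) : ℝ := ‖(S0 a t).comp (inclusion a)‖

end UntwistedStrip

end

/-!
The Laplacian on the strip separates: on a product `g ⊗ h` of a Gaussian `g` in `x₁` and a
transversal eigenfunction `h` (the functions `mode a n`, sines of frequency `freq a n`, with
`freq a 0 ^ 2 = E₁`) the heat flow is explicit, since Gaussians flow to wider Gaussians. These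
flows of *wave packets* carry the whole proof.

*Generation.* Let `A` be a closed symmetric operator bounded above, and suppose that some solutions
of `c' = A c`, stable under time shifts, have initial values spanning a dense subspace. Then their
flow extends to a semigroup `T` of bounded operators and `A` is its generator
(`exists_isSemigroupGeneratedBy`). Indeed `(∫₀ʰ T s u ds, T h u - u)` is in the graph of `A` for every
`u`, because `A` is closed; dividing by `h` shows that `A` extends the generator, and testing
`(u, A u)` against these elements, by symmetry of `A` and `T h`, gives `T h u - u = ∫₀ʰ T s (A u) ds`,
so the generator extends `A`. No resolvent or spectral theorem is needed. The same symmetry shows that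
any semigroup generated by `A` acts on wave packets by the explicit flow (`S0_curve`,
`inner_S0_curve`), which identifies `S0`.

*The operator.* The form domain is closed, hence so is the operator of the form
(`isClosed_formOperator`). A wave packet is in its domain (`mem_formOperator_tensor`): cut-offs
approximate it in the form domain, and Green's formula holds against test functions with a boundary
term on `ℝ × {-a}`, which disappears for functions with zero trace. Density of wave packets
(`eq_zero_of_inner_curve_eq_zero`) follows from uniqueness of moment generating functions, applied
once in `x₁` and once in `cos 2θ(x₂)`, of which the modes are polynomials up to the factor `sin θ`.

*Decay.* By symmetry of `S0 a t` it suffices to bound it from `L²(Ω)` to `L²(Ω, K⁻¹)`. On a sum of wave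
packets, each longitudinal coefficient at a point `x₁` is the inner product of its initial value with
a heat kernel, of `L²` norm of order `t^{-1/4}`; the modes are orthogonal and `K⁻¹` is integrable in
`x₁` (`integral_weight_inv_mul_sq_le`). The first mode times a Gaussian attains the rate
(`norm_sq_curve_ground`), since it decays only through its spreading in `x₁`.
-/

noncomputable section

namespace UntwistedStrip

/-! ### Semigroups generated by symmetric operators -/

section Abstract

variable {H : Type*} [NormedAddCommGroup H] [InnerProductSpace ℝ H]

/-- Symmetry of an operator, given by its graph. -/
def IsSymmetricGraph (A : Set (H × H)) : Prop :=
  ∀ p ∈ A, ∀ q ∈ A, inner ℝ p.2 q.1 = inner ℝ p.1 q.2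

/-- A family of solutions `c i` of `c' = A c` on `[0, ∞)` which is stable under time shifts, up to
scalar factors, and whose initial values span a dense subspace. -/
structure IsSolutionFamily {ι : Type*} (A : Set (H × H)) (c c' : ι → ℝ → H) : Prop where
  hasDerivAt : ∀ i t, 0 ≤ t → HasDerivAt (c i) (c' i t) t
  mem : ∀ i t, 0 ≤ t → (c i t, c' i t) ∈ A
  shift : ∀ i t, 0 ≤ t → ∃ (r : ℝ) (j : ι), ∀ s, 0 ≤ s → c i (s + t) = r • c j s
  dense : Dense (Submodule.span ℝ (range fun i => c i 0) : Set H)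

/-- A trajectory `u` (differentiable from the right) and a trajectory `v` of a symmetric operator
satisfy `⟪u t, v 0⟫ = ⟪u 0, v t⟫`, because `s ↦ ⟪u s, v (t - s)⟫` has vanishing derivative. -/
theorem inner_trajectories {A : Set (H × H)} (hA : IsSymmetricGraph A) {u u' v v' : ℝ → H}
    (hu : ContinuousOn u (Ici 0))
    (hu' : ∀ t, 0 ≤ t → HasDerivWithinAt u (u' t) (Ici t) t)
    (huA : ∀ t, 0 ≤ t → (u t, u' t) ∈ A)
    (hv : ∀ t, 0 ≤ t → HasDerivAt v (v' t) t) (hvA : ∀ t, 0 ≤ t → (v t, v' t) ∈ A)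
    {t : ℝ} (ht : 0 ≤ t) : inner ℝ (u t) (v 0) = inner ℝ (u 0) (v t) := by
  have hd : ∀ s ∈ Icc 0 t, HasDerivAt (fun s => v (t - s)) (-(v' (t - s))) s := by
    intro s hs
    have hts : 0 ≤ t - s := by linarith [hs.2]
    simpa using! (hv (t - s) hts).scomp s ((hasDerivAt_id s).const_sub t)
  have key := constant_of_has_deriv_right_zero (a := 0) (b := t)
    (f := fun s => inner ℝ (u s) (v (t - s))) ?_ ?_ t ⟨ht, le_rfl⟩
  · simpa using key
  · exact (hu.mono fun s hs => hs.1).inner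
      fun s hs => (hd s hs).continuousAt.continuousWithinAt
  · intro s hs
    have h := (hu' s hs.1).inner ℝ (hd s ⟨hs.1, hs.2.le⟩).hasDerivWithinAt
    refine h.congr_deriv ?_
    have := hA _ (huA s hs.1) _ (hvA (t - s) (by linarith [hs.2]))
    simp only at this
    rw [inner_neg_right, this]
    exact neg_add_cancel _

namespace IsSemigroupGeneratedBy

variable {A : Set (H × H)} {T : ℝ → H →L[ℝ] H}

theorem hasDerivWithinAt (hT : IsSemigroupGeneratedBy A T) {u f : H} (huf : (u, f) ∈ A)
    {t : ℝ} (ht : 0 ≤ t) : HasDerivWithinAt (fun s => T s u) (T t f) (Ici t) t := by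
  have h0 := (hT.generator u f).1 huf
  rw [← hasDerivWithinAt_Ioi_iff_Ici, hasDerivWithinAt_iff_tendsto_slope' (by simp)]
  have hsub : Tendsto (fun s => s - t) (𝓝[>] t) (𝓝[>] 0) := by
    refine tendsto_nhdsWithin_iff.2 ⟨?_, ?_⟩
    · have : Tendsto (fun s => s - t) (𝓝 t) (𝓝 (t - t)) :=
        Continuous.tendsto (by fun_prop) t
      rw [sub_self] at this
      exact this.mono_left nhdsWithin_le_nhds
    · filter_upwards [self_mem_nhdsWithin] with s hs
      exact sub_pos.2 (mem_Ioi.1 hs)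
  refine (((T t).continuous.tendsto f).comp (h0.comp hsub)).congr' ?_
  filter_upwards [self_mem_nhdsWithin] with s hs
  have hs : 0 ≤ s - t := (sub_pos.2 hs).le
  have h1 := DFunLike.congr_fun (hT.map_add t (s - t) ht hs) u
  simp only [ContinuousLinearMap.comp_apply, add_sub_cancel] at h1
  simp [slope_def_module, h1]

theorem mem_apply (hT : IsSemigroupGeneratedBy A T) {u f : H} (huf : (u, f) ∈ A)
    {t : ℝ} (ht : 0 ≤ t) : (T t u, T t f) ∈ A := by
  rw [hT.generator]
  have h0 := ((T t).continuous.tendsto f).comp ((hT.generator u f).1 huf)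
  refine h0.congr' ?_
  filter_upwards [self_mem_nhdsWithin] with s hs
  have hs : (0 : ℝ) < s := hs
  have h1 := DFunLike.congr_fun (hT.map_add s t hs.le ht) u
  have h2 := DFunLike.congr_fun (hT.map_add t s ht hs.le) u
  simp only [ContinuousLinearMap.comp_apply] at h1 h2
  simp only [Function.comp, map_smul, map_sub]
  rw [← h1, ← h2, add_comm s t]

end IsSemigroupGeneratedBy

/-- A semigroup generated by a symmetric operator is adjoint to the flow of the solution family. -/
theorem IsSemigroupGeneratedBy.inner_apply {A : Set (H × H)} {T : ℝ → H →L[ℝ] H}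
    (hT : IsSemigroupGeneratedBy A T) (hA : IsSymmetricGraph A) {ι : Type*} {c c' : ι → ℝ → H}
    (hc : IsSolutionFamily A c c') (u : H) (i : ι) {t : ℝ} (ht : 0 ≤ t) :
    inner ℝ (T t u) (c i 0) = inner ℝ u (c i t) := by
  have h1 : ∀ u ∈ Submodule.span ℝ (range fun i => c i 0),
      inner ℝ (T t u) (c i 0) = inner ℝ u (c i t) := by
    intro u hu
    induction hu using Submodule.span_induction with
    | mem u hu =>
      obtain ⟨j, rfl⟩ := hu
      have h := inner_trajectories hA (hT.continuousOn (c j 0))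
        (fun s hs => hT.hasDerivWithinAt (hc.mem j 0 le_rfl) hs)
        (fun s hs => hT.mem_apply (hc.mem j 0 le_rfl) hs) (hc.hasDerivAt i) (hc.mem i) ht
      simpa [hT.map_zero] using h
    | zero => simp
    | add x y _ _ hx hy => simp [inner_add_left, hx, hy]
    | smul r x _ hx => simp [inner_smul_left, hx]
  have h2 := Continuous.ext_on hc.dense (f := fun u => inner ℝ (T t u) (c i 0))
    (g := fun u => inner ℝ u (c i t)) (by fun_prop) (by fun_prop) h1
  exact congrFun h2 u

/-- A semigroup generated by a symmetric operator moves initial values along the given solutions; in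
particular it is unique. -/
theorem IsSemigroupGeneratedBy.apply_eq {A : Set (H × H)} {T : ℝ → H →L[ℝ] H}
    (hT : IsSemigroupGeneratedBy A T) (hA : IsSymmetricGraph A) {ι : Type*} {c c' : ι → ℝ → H}
    (hc : IsSolutionFamily A c c') (i : ι) {t : ℝ} (ht : 0 ≤ t) : T t (c i 0) = c i t := by
  refine hc.dense.eq_of_inner_left ℝ fun v hv => ?_
  induction hv using Submodule.span_induction with
  | mem v hv =>
    obtain ⟨j, rfl⟩ := hv
    simp only
    rw [hT.inner_apply hA hc _ j ht]
    refine (inner_trajectories hA ?_ ?_ (hc.mem i) (hc.hasDerivAt j) (hc.mem j) ht).symm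
    · exact fun s hs => (hc.hasDerivAt i s hs).continuousAt.continuousWithinAt
    · exact fun s hs => (hc.hasDerivAt i s hs).hasDerivWithinAt
  | zero => simp
  | add x y _ _ hx hy => simp [inner_add_right, hx, hy]
  | smul r x _ hx => simp [inner_smul_right, hx]

/-- Solutions of `c' = A c` grow at most like `exp (γ t)` if `⟪A u, u⟫ ≤ γ ‖u‖²`. -/
theorem norm_trajectory_le {A : Set (H × H)} {γ : ℝ}
    (hγ : ∀ p ∈ A, inner ℝ p.2 p.1 ≤ γ * ‖p.1‖ ^ 2) {v v' : ℝ → H}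
    (hv : ∀ t, 0 ≤ t → HasDerivAt v (v' t) t) (hvA : ∀ t, 0 ≤ t → (v t, v' t) ∈ A)
    {t : ℝ} (ht : 0 ≤ t) : ‖v t‖ ≤ Real.exp (γ * t) * ‖v 0‖ := by
  have hd : ∀ s, 0 ≤ s → HasDerivAt (fun s => Real.exp (-(2 * γ) * s) * ‖v s‖ ^ 2)
      (Real.exp (-(2 * γ) * s) * (2 * (inner ℝ (v s) (v' s) - γ * ‖v s‖ ^ 2))) s := by
    intro s hs
    have h1 : HasDerivAt (fun s => Real.exp (-(2 * γ) * s))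
        (Real.exp (-(2 * γ) * s) * (-(2 * γ))) s := by
      simpa using ((hasDerivAt_id s).const_mul (-(2 * γ))).exp
    exact (h1.mul (hv s hs).norm_sq).congr_deriv (by ring)
  have hanti : AntitoneOn (fun s => Real.exp (-(2 * γ) * s) * ‖v s‖ ^ 2) (Ici 0) := by
    refine antitoneOn_of_deriv_nonpos (convex_Ici 0)
      (fun s hs => (hd s hs).continuousAt.continuousWithinAt) ?_ ?_
    · intro s hs
      rw [interior_Ici] at hs
      exact (hd s (le_of_lt hs)).differentiableAt.differentiableWithinAt
    · intro s hs
      rw [interior_Ici] at hs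
      have hs : 0 ≤ s := le_of_lt hs
      rw [(hd s hs).deriv]
      have := hγ _ (hvA s hs)
      rw [real_inner_comm] at this
      exact mul_nonpos_of_nonneg_of_nonpos (Real.exp_pos _).le (by linarith)
  have h := hanti (mem_Ici.2 le_rfl) (mem_Ici.2 ht) ht
  simp only [mul_zero, Real.exp_zero, one_mul] at h
  refine le_of_sq_le_sq ?_ (by positivity)
  rw [mul_pow, ← Real.exp_nat_mul]
  calc ‖v t‖ ^ 2 = Real.exp (2 * γ * t) * (Real.exp (-(2 * γ) * t) * ‖v t‖ ^ 2) := by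
        rw [← mul_assoc, ← Real.exp_add]; simp
    _ ≤ Real.exp (2 * γ * t) * ‖v 0‖ ^ 2 := by gcongr
    _ = _ := by congr 2; push_cast; ring

/-- One-sided fundamental theorem of calculus. -/
theorem hasDerivWithinAt_integral {f : ℝ → H} [CompleteSpace H] (hf : ContinuousOn f (Ici 0))
    {t : ℝ} (ht : 0 ≤ t) : HasDerivWithinAt (fun h => ∫ s in 0..h, f s) (f t) (Ici t) t := by
  refine intervalIntegral.integral_hasDerivWithinAt_right ?_ (t := Ioi t) ?_ ?_
  · refine (hf.mono ?_).intervalIntegrable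
    rw [uIcc_of_le ht]
    exact fun s hs => hs.1
  · exact (hf.mono fun s hs => (ht.trans (le_of_lt hs) : 0 ≤ s)).stronglyMeasurableAtFilter_nhdsWithin
      measurableSet_Ioi t
  · exact (hf t ht).mono fun s hs => (ht.trans (le_of_lt hs) : 0 ≤ s)

/-- A curve starting at `0` whose velocity stays in a closed subspace stays in that subspace. -/
theorem mem_of_hasDerivWithinAt_mem {E : Type*} [NormedAddCommGroup E] [NormedSpace ℝ E]
    (A : Submodule ℝ E) (hA : IsClosed (A : Set E)) {P P' : ℝ → E} (h0 : P 0 = 0)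
    {t : ℝ} (ht : 0 ≤ t) (hP : ContinuousOn P (Icc 0 t))
    (hP' : ∀ t, 0 ≤ t → HasDerivWithinAt P (P' t) (Ici t) t) (hmem : ∀ t, 0 ≤ t → P' t ∈ A) :
    P t ∈ A := by
  have := hA
  have key := constant_of_has_deriv_right_zero (a := 0) (b := t) (f := fun s => A.mkQL (P s))
    (A.mkQL.continuous.comp_continuousOn hP) ?_ t ⟨ht, le_rfl⟩
  · simpa [h0] using key
  · intro s hs
    refine (A.mkQL.hasFDerivAt.comp_hasDerivWithinAt s (hP' s hs.1)).congr_deriv ?_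
    simpa using hmem s hs.1

/-- A closed symmetric operator bounded above generates a strongly continuous semigroup as soon as it
has a solution family: the flow of the family extends by density. -/
theorem exists_isSemigroupGeneratedBy [CompleteSpace H] (A : Submodule ℝ (H × H))
    (hclosed : IsClosed (A : Set (H × H))) (hsymm : IsSymmetricGraph (A : Set (H × H))) {γ : ℝ}
    (hγ : ∀ p ∈ A, inner ℝ p.2 p.1 ≤ γ * ‖p.1‖ ^ 2) {ι : Type*} {c c' : ι → ℝ → H}
    (hc : IsSolutionFamily (A : Set (H × H)) c c') :
    ∃ T : ℝ → H →L[ℝ] H, IsSemigroupGeneratedBy (A : Set (H × H)) T := by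
  -- `L t a` is the solution whose initial value is the linear combination `L 0 a`.
  let L : ℝ → (ι →₀ ℝ) →ₗ[ℝ] H := fun t => Finsupp.linearCombination ℝ fun i => c i t
  let L' : ℝ → (ι →₀ ℝ) →ₗ[ℝ] H := fun t => Finsupp.linearCombination ℝ fun i => c' i t
  have hLd : ∀ a t, 0 ≤ t → HasDerivAt (fun t => L t a) (L' t a) t := fun a t ht => by
    simp only [L, L', Finsupp.linearCombination_apply, Finsupp.sum]
    exact HasDerivAt.fun_sum fun i _ => (hc.hasDerivAt i t ht).const_smul (a i)
  have hLA : ∀ a t, 0 ≤ t → (L t a, L' t a) ∈ A := fun a t ht => by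
    have : (L t a, L' t a) = ∑ i ∈ a.support, a i • (c i t, c' i t) := by
      simp [L, L', Finsupp.linearCombination_apply, Finsupp.sum, Prod.ext_iff, Prod.fst_sum,
        Prod.snd_sum]
    rw [this]
    exact A.sum_mem fun i _ => A.smul_mem _ (hc.mem i t ht)
  have hLn : ∀ t, 0 ≤ t → ∀ a, ‖L t a‖ ≤ Real.exp (γ * t) * ‖L 0 a‖ := fun t ht a =>
    norm_trajectory_le hγ (hLd a) (hLA a) ht
  have hdense : DenseRange (L 0) := by
    have := hc.dense
    rwa [← Finsupp.range_linearCombination] at this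
  let T : ℝ → H →L[ℝ] H := fun t => (L t).extendOfNorm (L 0)
  have hTL : ∀ t, 0 ≤ t → ∀ a, T t (L 0 a) = L t a := fun t ht a =>
    LinearMap.extendOfNorm_eq hdense ⟨_, hLn t ht⟩ a
  have hTn : ∀ t, 0 ≤ t → ∀ u, ‖T t u‖ ≤ Real.exp (γ * t) * ‖u‖ := fun t ht u =>
    LinearMap.norm_extendOfNorm_apply_le hdense _ (hLn t ht) u
  have hTc : ∀ t, 0 ≤ t → ∀ i, T t (c i 0) = c i t := fun t ht i => by
    simpa [L] using hTL t ht (Finsupp.single i 1)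
  have hTn' : ∀ N t, 0 ≤ t → t ≤ N → ∀ u, ‖T t u‖ ≤ Real.exp (|γ| * N) * ‖u‖ := by
    intro N t ht hN u
    refine (hTn t ht u).trans ?_
    gcongr
    exact le_abs_self γ
  have hcont : ∀ u, ContinuousOn (fun t => T t u) (Ici 0) := by
    intro u
    refine continuousOn_of_locally_uniform_approx_of_continuousWithinAt fun t ht U hU => ?_
    obtain ⟨ε, hε, hεU⟩ := Metric.mem_uniformity_dist.1 hU
    have hM := Real.exp_pos (|γ| * (t + 1))
    obtain ⟨a, ha⟩ := hdense.exists_dist_lt u (div_pos hε hM)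
    refine ⟨Ici 0 ∩ Iic (t + 1), inter_mem_nhdsWithin _ (Iic_mem_nhds (by linarith)),
      fun s => T s (L 0 a), ?_, ?_⟩
    · exact (hLd a t ht).continuousAt.continuousWithinAt.congr (fun s hs => hTL s hs a)
        (hTL t ht a)
    · intro s hs
      refine hεU ?_
      rw [dist_eq_norm, ← map_sub]
      refine (hTn' (t + 1) s hs.1 hs.2 _).trans_lt ?_
      rw [← dist_eq_norm]
      rwa [lt_div_iff₀ hM, mul_comm] at ha
  have hT0 : T 0 = ContinuousLinearMap.id ℝ H := by
    refine ContinuousLinearMap.coeFn_injective (hdense.equalizer (T 0).continuous continuous_id ?_)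
    funext a
    exact hTL 0 le_rfl a
  have hadd : ∀ s t : ℝ, 0 ≤ s → 0 ≤ t → T (s + t) = (T s).comp (T t) := by
    intro s t hs ht
    refine ContinuousLinearMap.ext_on hc.dense ?_
    rintro _ ⟨i, rfl⟩
    obtain ⟨r, j, hj⟩ := hc.shift i t ht
    have h0 := hj 0 le_rfl
    rw [zero_add] at h0
    simp only [ContinuousLinearMap.comp_apply]
    rw [hTc _ (by positivity) i, hTc t ht, h0, map_smul, hTc s hs, hj s hs]
  have hTsymm : ∀ t, 0 ≤ t → ∀ u v, inner ℝ (T t u) v = inner ℝ u (T t v) := by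
    intro t ht u v
    refine hdense.induction_on₂ (p := fun u v => inner ℝ (T t u) v = inner ℝ u (T t v)) ?_ ?_ u v
    · exact isClosed_eq (by fun_prop) (by fun_prop)
    · intro a b
      rw [hTL t ht, hTL t ht]
      exact inner_trajectories hsymm (fun s hs => (hLd a s hs).continuousAt.continuousWithinAt)
        (fun s hs => (hLd a s hs).hasDerivWithinAt) (hLA a) (hLd b) (hLA b) ht
  have hint : ∀ u h, 0 ≤ h → IntervalIntegrable (fun s => T s u) volume 0 h := by
    intro u h hh
    refine ((hcont u).mono ?_).intervalIntegrable
    rw [uIcc_of_le hh]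
    exact fun s hs => hs.1
  -- `(∫₀ʰ T s u ds, T h u - u)` belongs to the graph, for every `u`.
  have hV : ∀ h, 0 ≤ h → ∀ u, (∫ s in 0..h, T s u, T h u - u) ∈ A := by
    intro h hh u
    have hLip : LipschitzWith (Real.toNNReal (Real.exp (|γ| * h) * |h - 0|))
        fun u => ∫ s in 0..h, T s u := by
      refine LipschitzWith.of_dist_le' fun u v => ?_
      rw [dist_eq_norm, ← intervalIntegral.integral_sub (hint u h hh) (hint v h hh), mul_right_comm]
      refine intervalIntegral.norm_integral_le_of_norm_le_const fun s hs => ?_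
      rw [uIoc_of_le hh] at hs
      rw [← map_sub, dist_eq_norm]
      exact hTn' h s hs.1.le hs.2 _
    refine hdense.induction_on (p := fun u => (∫ s in 0..h, T s u, T h u - u) ∈ A) u ?_ ?_
    · exact hclosed.preimage (hLip.continuous.prodMk (by fun_prop))
    · intro a
      have hLc : ContinuousOn (fun s => L s a) (Ici 0) :=
        fun s hs => (hLd a s hs).continuousAt.continuousWithinAt
      have key := mem_of_hasDerivWithinAt_mem A hclosed
        (P := fun h => (∫ s in 0..h, L s a, L h a - L 0 a)) (P' := fun h => (L h a, L' h a))
        (by simp) hh ?_ ?_ (hLA a)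
      · rw [hTL h hh]
        convert key using 2
        refine intervalIntegral.integral_congr fun s hs => ?_
        rw [uIcc_of_le hh] at hs
        exact hTL s hs.1 a
      · have hLc' := hLc.mono fun s (hs : s ∈ Icc 0 h) => hs.1
        refine ContinuousOn.prodMk ?_ (hLc'.sub continuousOn_const)
        rw [← uIcc_of_le hh] at hLc' ⊢
        exact intervalIntegral.continuousOn_primitive_interval
          (hLc'.integrableOn_compact isCompact_uIcc)
      · intro s hs
        exact (hasDerivWithinAt_integral hLc hs).prodMk
          ((hLd a s hs).hasDerivWithinAt.sub_const _)
  have hslope : ∀ u, Tendsto (fun h : ℝ => h⁻¹ • ∫ s in 0..h, T s u) (𝓝[>] 0) (𝓝 u) := by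
    intro u
    have h := hasDerivWithinAt_integral (hcont u) le_rfl
    rw [← hasDerivWithinAt_Ioi_iff_Ici, hasDerivWithinAt_iff_tendsto_slope' (by simp)] at h
    simpa [slope_fun_def, hT0] using h
  -- Both inclusions follow from `hV`: by symmetry (first) and by closedness (second).
  refine ⟨T, hT0, hadd, hcont, fun u f => ⟨fun huf => ?_, fun hlim => ?_⟩⟩
  · refine (hslope f).congr' ?_
    filter_upwards [self_mem_nhdsWithin] with h hh
    have hh : 0 ≤ h := le_of_lt hh
    congr 1
    refine ext_inner_right ℝ fun v => ?_
    have h1 := hsymm _ huf _ (hV h hh v)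
    simp only at h1
    have h2 : inner ℝ f (∫ s in 0..h, T s v) = inner ℝ (∫ s in 0..h, T s f) v := by
      rw [real_inner_comm v]
      have e1 := (innerSL ℝ f).intervalIntegral_comp_comm (hint v h hh)
      have e2 := (innerSL ℝ v).intervalIntegral_comp_comm (hint f h hh)
      simp only [innerSL_apply_apply] at e1 e2
      rw [← e1, ← e2]
      refine intervalIntegral.integral_congr fun s hs => ?_
      rw [uIcc_of_le hh] at hs
      rw [← hTsymm s hs.1, real_inner_comm]
    rw [← h2, h1, inner_sub_left, inner_sub_right, hTsymm h hh]
  · have h1 := (hslope u).prodMk_nhds hlim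
    refine hclosed.mem_of_tendsto h1 ?_
    filter_upwards [self_mem_nhdsWithin] with h hh
    exact A.smul_mem h⁻¹ (hV h (le_of_lt hh) u)

end Abstract

/-! ### Operators associated with quadratic forms -/

section FormOperator

variable {H : Type*} [NormedAddCommGroup H] [InnerProductSpace ℝ H]

/-- The graph of the operator associated with the quadratic form `‖∇u‖²`, where the possible pairs
of a function `u` of the form domain and its gradient `∇u = (g₁, g₂)` are the elements of `F`. -/
def formOperator (F : Submodule ℝ (H × H × H)) : Submodule ℝ (H × H) where
  carrier := {p | ∃ g₁ g₂ : H, (p.1, g₁, g₂) ∈ F ∧ ∀ v h₁ h₂ : H, (v, h₁, h₂) ∈ F →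
    inner ℝ g₁ h₁ + inner ℝ g₂ h₂ = inner ℝ p.2 v}
  zero_mem' := ⟨0, 0, F.zero_mem, by simp⟩
  add_mem' := by
    rintro p q ⟨g₁, g₂, hg, hp⟩ ⟨k₁, k₂, hk, hq⟩
    refine ⟨g₁ + k₁, g₂ + k₂, F.add_mem hg hk, fun v h₁ h₂ hv => ?_⟩
    rw [Prod.snd_add, inner_add_left, inner_add_left, inner_add_left, ← hp v h₁ h₂ hv,
      ← hq v h₁ h₂ hv]
    ring
  smul_mem' := by
    rintro r p ⟨g₁, g₂, hg, hp⟩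
    refine ⟨r • g₁, r • g₂, F.smul_mem r hg, fun v h₁ h₂ hv => ?_⟩
    rw [Prod.smul_snd, real_inner_smul_left, real_inner_smul_left, real_inner_smul_left,
      ← hp v h₁ h₂ hv]
    ring

theorem isSymmetricGraph_formOperator (F : Submodule ℝ (H × H × H)) :
    IsSymmetricGraph (formOperator F : Set (H × H)) := by
  rintro p ⟨g₁, g₂, hg, hp⟩ q ⟨k₁, k₂, hk, hq⟩
  rw [← hp _ _ _ hk, real_inner_comm q.2, ← hq _ _ _ hg, real_inner_comm k₁, real_inner_comm k₂]

theorem inner_nonneg_of_mem_formOperator {F : Submodule ℝ (H × H × H)} {p : H × H}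
    (hp : p ∈ formOperator F) : 0 ≤ inner ℝ p.2 p.1 := by
  obtain ⟨g₁, g₂, hg, hp⟩ := hp
  rw [← hp _ _ _ hg]
  exact add_nonneg real_inner_self_nonneg real_inner_self_nonneg

/-- The operator of a closed form is closed: along a convergent sequence `(uₙ, fₙ)` of its graph the
gradients are Cauchy, since `‖∇(uₙ - uₘ)‖² = ⟪fₙ - fₘ, uₙ - uₘ⟫`. -/
theorem isClosed_formOperator [CompleteSpace H] {F : Submodule ℝ (H × H × H)}
    (hF : IsClosed (F : Set (H × H × H))) : IsClosed (formOperator F : Set (H × H)) := by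
  refine IsSeqClosed.isClosed fun p q hp hpq => ?_
  choose g k hg hp using hp
  have hid : ∀ n m, ‖g n - g m‖ ^ 2 + ‖k n - k m‖ ^ 2
      = inner ℝ (p n - p m).2 (p n - p m).1 := by
    intro n m
    have hF := F.sub_mem (hg n) (hg m)
    rw [← real_inner_self_eq_norm_sq, ← real_inner_self_eq_norm_sq, Prod.snd_sub, Prod.fst_sub,
      inner_sub_left (p n).2, ← hp n _ _ _ hF, ← hp m _ _ _ hF]
    simp only [inner_sub_left]
    ring
  have hlim : Tendsto (fun x : ℕ × ℕ => inner ℝ (p x.1 - p x.2).2 (p x.1 - p x.2).1)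
      atTop (𝓝 0) := by
    have h1 : Tendsto (fun x : ℕ × ℕ => p x.1 - p x.2) atTop (𝓝 (q - q)) := by
      rw [← prod_atTop_atTop_eq]
      exact (hpq.comp tendsto_fst).sub (hpq.comp tendsto_snd)
    have h2 : Continuous fun r : H × H => inner ℝ r.2 r.1 := by fun_prop
    have h3 : inner ℝ (q - q).2 (q - q).1 = 0 := by simp
    rw [← h3]
    exact (h2.tendsto _).comp h1
  -- Either component of the gradient satisfies the hypothesis on `w`.
  have hcauchy : ∀ w : ℕ → H, (∀ n m, ‖w n - w m‖ ^ 2 ≤ inner ℝ (p n - p m).2 (p n - p m).1) →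
      CauchySeq w := by
    intro w hw
    rw [cauchySeq_iff_tendsto_dist_atTop_0]
    have h1 : Tendsto (fun x : ℕ × ℕ => ‖w x.1 - w x.2‖ ^ 2) atTop (𝓝 0) :=
      squeeze_zero (fun _ => by positivity) (fun x => hw x.1 x.2) hlim
    simpa [dist_eq_norm, Real.sqrt_sq] using h1.sqrt
  obtain ⟨g₀, hg₀⟩ := cauchySeq_tendsto_of_complete
    (hcauchy g fun n m => by rw [← hid]; exact le_add_of_nonneg_right (by positivity))
  obtain ⟨k₀, hk₀⟩ := cauchySeq_tendsto_of_complete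
    (hcauchy k fun n m => by rw [← hid]; exact le_add_of_nonneg_left (by positivity))
  have hq1 := (continuous_fst.tendsto q).comp hpq
  have hq2 := (continuous_snd.tendsto q).comp hpq
  refine ⟨g₀, k₀, hF.mem_of_tendsto (hq1.prodMk_nhds (hg₀.prodMk_nhds hk₀))
    (Eventually.of_forall hg), fun v h₁ h₂ hv => ?_⟩
  refine tendsto_nhds_unique ((hg₀.inner tendsto_const_nhds).add (hk₀.inner tendsto_const_nhds))
    ((hq2.inner (tendsto_const_nhds (x := v))).congr fun n => ?_)
  exact (hp n v h₁ h₂ hv).symm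

end FormOperator

/-! ### The form domain and the shifted Laplacian -/

instance (a : ℝ) : IsFiniteMeasureOnCompacts (stripMeasure a) := by
  unfold stripMeasure; infer_instance

/-- The space `C₀^∞(ℝ²)`. -/
def testFunctions : Submodule ℝ (ℝ × ℝ → ℝ) where
  carrier := {φ | ContDiff ℝ ∞ φ ∧ HasCompactSupport φ}
  zero_mem' := ⟨contDiff_const, HasCompactSupport.zero⟩
  add_mem' := fun h k => ⟨h.1.add k.1, h.2.add k.2⟩
  smul_mem' := fun r _ h => ⟨contDiff_const.smul h.1, h.2.smul_left (f := fun _ => r)⟩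

theorem contDiff_partial1 {φ : ℝ × ℝ → ℝ} (hφ : ContDiff ℝ ∞ φ) : ContDiff ℝ ∞ (partial1 φ) :=
  (hφ.fderiv_right (m := ∞) (by simp)).clm_apply contDiff_const

theorem contDiff_partial2 {φ : ℝ × ℝ → ℝ} (hφ : ContDiff ℝ ∞ φ) : ContDiff ℝ ∞ (partial2 φ) :=
  (hφ.fderiv_right (m := ∞) (by simp)).clm_apply contDiff_const

theorem hasCompactSupport_partial1 {φ : ℝ × ℝ → ℝ} (hφ : HasCompactSupport φ) :
    HasCompactSupport (partial1 φ) := hφ.fderiv_apply ℝ (1, 0)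

theorem hasCompactSupport_partial2 {φ : ℝ × ℝ → ℝ} (hφ : HasCompactSupport φ) :
    HasCompactSupport (partial2 φ) := hφ.fderiv_apply ℝ (0, 1)

theorem hasCompactSupport_slice {φ : ℝ × ℝ → ℝ} (hφ : HasCompactSupport φ) (b : ℝ) :
    HasCompactSupport fun s => φ (s, b) :=
  HasCompactSupport.intro (hφ.isCompact.image continuous_fst) fun s hs =>
    image_eq_zero_of_notMem_tsupport fun h => hs ⟨(s, b), h, rfl⟩

namespace testFunctions

variable (φ : testFunctions) (a : ℝ)

theorem memLp : MemLp φ.1 2 (stripMeasure a) :=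
  φ.2.1.continuous.memLp_of_hasCompactSupport φ.2.2

theorem memLp_partial1 : MemLp (partial1 φ.1) 2 (stripMeasure a) :=
  (contDiff_partial1 φ.2.1).continuous.memLp_of_hasCompactSupport (hasCompactSupport_partial1 φ.2.2)

theorem memLp_partial2 : MemLp (partial2 φ.1) 2 (stripMeasure a) :=
  (contDiff_partial2 φ.2.1).continuous.memLp_of_hasCompactSupport (hasCompactSupport_partial2 φ.2.2)

theorem memLp_slice : MemLp (fun s => φ.1 (s, -a)) 2 (volume : Measure ℝ) :=
  (φ.2.1.continuous.comp (by fun_prop)).memLp_of_hasCompactSupport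
    (hasCompactSupport_slice φ.2.2 (-a))

end testFunctions

/-- `φ ↦ (φ, ∂₁φ, ∂₂φ, φ|_{x₂ = -a})` on `C₀^∞(ℝ²)`. -/
def testGraph (a : ℝ) :
    testFunctions →ₗ[ℝ] L2 a × L2 a × L2 a × Lp ℝ 2 (volume : Measure ℝ) where
  toFun φ := ((testFunctions.memLp φ a).toLp, (testFunctions.memLp_partial1 φ a).toLp, (testFunctions.memLp_partial2 φ a).toLp,
    (testFunctions.memLp_slice φ a).toLp)
  map_add' φ ψ := by
    have hφ := fun x => (φ.2.1.differentiable (by simp)) x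
    have hψ := fun x => (ψ.2.1.differentiable (by simp)) x
    simp only [Prod.mk_add_mk, ← MemLp.toLp_add]
    refine Prod.ext rfl (Prod.ext ?_ (Prod.ext ?_ rfl)) <;> dsimp only <;> congr 1 <;> funext x
    · simp [partial1, fderiv_add (hφ x) (hψ x)]
    · simp [partial2, fderiv_add (hφ x) (hψ x)]
  map_smul' r φ := by
    have hφ := fun x => (φ.2.1.differentiable (by simp)) x
    simp only [Prod.smul_mk, ← MemLp.toLp_const_smul, RingHom.id_apply]
    refine Prod.ext rfl (Prod.ext ?_ (Prod.ext ?_ rfl)) <;> dsimp only <;> congr 1 <;> funext x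
    · simp [partial1, fderiv_const_smul (hφ x)]
    · simp [partial2, fderiv_const_smul (hφ x)]

/-- Having trace `τ` is a closed linear condition on the function, its gradient and `τ`. -/
theorem hasLowerTrace_iff {a : ℝ} {u g₁ g₂ : L2 a} {τ : Lp ℝ 2 (volume : Measure ℝ)} :
    HasLowerTrace u g₁ g₂ τ ↔ (u, g₁, g₂, τ) ∈ (LinearMap.range (testGraph a)).topologicalClosure := by
  rw [← SetLike.mem_coe, Submodule.topologicalClosure_coe, mem_closure_iff_seq_limit]
  have key : ∀ φ : ℕ → testFunctions,
      Tendsto (fun n => testGraph a (φ n)) atTop (𝓝 (u, g₁, g₂, τ)) ↔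
      Tendsto (fun n => eLpNorm (fun x => (φ n).1 x - u x) 2 (stripMeasure a)) atTop (𝓝 0) ∧
      Tendsto (fun n => eLpNorm (fun x => partial1 (φ n).1 x - g₁ x) 2 (stripMeasure a)) atTop
        (𝓝 0) ∧
      Tendsto (fun n => eLpNorm (fun x => partial2 (φ n).1 x - g₂ x) 2 (stripMeasure a)) atTop
        (𝓝 0) ∧
      Tendsto (fun n => eLpNorm (fun s : ℝ => (φ n).1 (s, -a) - τ s) 2 volume) atTop (𝓝 0) := by
    intro φ
    have h1 := Lp.tendsto_Lp_iff_tendsto_eLpNorm'' (fi := atTop) _ (fun n => testFunctions.memLp (φ n) a) _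
      (Lp.memLp u)
    have h2 := Lp.tendsto_Lp_iff_tendsto_eLpNorm'' (fi := atTop) _
      (fun n => testFunctions.memLp_partial1 (φ n) a) _ (Lp.memLp g₁)
    have h3 := Lp.tendsto_Lp_iff_tendsto_eLpNorm'' (fi := atTop) _
      (fun n => testFunctions.memLp_partial2 (φ n) a) _ (Lp.memLp g₂)
    have h4 := Lp.tendsto_Lp_iff_tendsto_eLpNorm'' (fi := atTop) _
      (fun n => testFunctions.memLp_slice (φ n) a) _ (Lp.memLp τ)
    rw [Lp.toLp_coeFn] at h1 h2 h3 h4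
    rw [Prod.tendsto_iff, Prod.tendsto_iff, Prod.tendsto_iff]
    exact and_congr h1 (and_congr h2 (and_congr h3 h4))
  constructor
  · rintro ⟨φ, hφ, h⟩
    exact ⟨fun n => testGraph a ⟨φ n, hφ n⟩, fun n => ⟨_, rfl⟩, (key fun n => ⟨φ n, hφ n⟩).2 h⟩
  · rintro ⟨x, hx, h⟩
    choose φ hφ using hx
    obtain rfl := funext hφ
    exact ⟨fun n => (φ n).1, fun n => (φ n).2, (key φ).1 h⟩

/-- Integration against an `L²` function, as a bounded linear functional. -/
theorem integral_mul_eq_inner {α : Type*} [MeasurableSpace α] {μ : Measure α} (u : Lp ℝ 2 μ)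
    {ψ : α → ℝ} (hψ : MemLp ψ 2 μ) : ∫ x, u x * ψ x ∂μ = inner ℝ hψ.toLp u := by
  rw [L2.inner_def]
  refine integral_congr_ae ?_
  filter_upwards [hψ.coeFn_toLp] with x hx
  rw [hx]
  rfl

theorem hasWeakGradient_iff {a : ℝ} {u g₁ g₂ : L2 a} :
    HasWeakGradient u g₁ g₂ ↔ ∀ φ : testFunctions, tsupport φ.1 ⊆ strip a →
      inner ℝ (testFunctions.memLp_partial1 φ a).toLp u + inner ℝ (testFunctions.memLp φ a).toLp g₁ = 0 ∧
      inner ℝ (testFunctions.memLp_partial2 φ a).toLp u + inner ℝ (testFunctions.memLp φ a).toLp g₂ = 0 := by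
  constructor
  · intro h φ hφ
    have := h φ.1 φ.2.1 φ.2.2 hφ
    rw [integral_mul_eq_inner u (testFunctions.memLp_partial1 φ a), integral_mul_eq_inner u (testFunctions.memLp_partial2 φ a),
      integral_mul_eq_inner g₁ (testFunctions.memLp φ a), integral_mul_eq_inner g₂ (testFunctions.memLp φ a)] at this
    constructor <;> linarith
  · intro h φ h1 h2 hφ
    have := h ⟨φ, h1, h2⟩ hφ
    let φ' : testFunctions := ⟨φ, h1, h2⟩
    rw [integral_mul_eq_inner u (testFunctions.memLp_partial1 φ' a), integral_mul_eq_inner u (testFunctions.memLp_partial2 φ' a),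
      integral_mul_eq_inner g₁ (testFunctions.memLp φ' a), integral_mul_eq_inner g₂ (testFunctions.memLp φ' a)]
    constructor <;> linarith

/-- The pairs of a function `u` of the form domain and its gradient. -/
def formDomain (a : ℝ) : Submodule ℝ (L2 a × L2 a × L2 a) where
  carrier := {p | InFormDomain p.1 p.2.1 p.2.2}
  zero_mem' := ⟨hasWeakGradient_iff.2 (by simp), hasLowerTrace_iff.2 (Submodule.zero_mem _)⟩
  add_mem' := by
    rintro p q ⟨hp, hp'⟩ ⟨hq, hq'⟩
    rw [hasWeakGradient_iff] at hp hq
    rw [hasLowerTrace_iff] at hp' hq'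
    refine ⟨hasWeakGradient_iff.2 fun φ hφ => ?_, hasLowerTrace_iff.2 ?_⟩
    · have h1 := hp φ hφ
      have h2 := hq φ hφ
      simp only [Prod.fst_add, Prod.snd_add, inner_add_right]
      constructor <;> linarith
    · simpa using Submodule.add_mem _ hp' hq'
  smul_mem' := by
    rintro r p ⟨hp, hp'⟩
    rw [hasWeakGradient_iff] at hp
    rw [hasLowerTrace_iff] at hp'
    refine ⟨hasWeakGradient_iff.2 fun φ hφ => ?_, hasLowerTrace_iff.2 ?_⟩
    · have h1 := hp φ hφ
      simp only [Prod.smul_fst, Prod.smul_snd, real_inner_smul_right, ← mul_add]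
      simp [h1]
    · simpa using Submodule.smul_mem _ r hp'

theorem isClosed_formDomain (a : ℝ) : IsClosed (formDomain a : Set (L2 a × L2 a × L2 a)) := by
  have h1 : IsClosed {p : L2 a × L2 a × L2 a | HasWeakGradient p.1 p.2.1 p.2.2} := by
    simp only [hasWeakGradient_iff, Set.ofPred_forall]
    refine isClosed_iInter fun φ => isClosed_iInter fun hφ => IsClosed.inter ?_ ?_ <;>
    exact isClosed_eq (by fun_prop) continuous_const
  have h2 : IsClosed {p : L2 a × L2 a × L2 a | HasLowerTrace p.1 p.2.1 p.2.2 0} := by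
    simp only [hasLowerTrace_iff]
    exact (Submodule.isClosed_topologicalClosure _).preimage
      (f := fun p : L2 a × L2 a × L2 a => (p.1, p.2.1, p.2.2, (0 : Lp ℝ 2 (volume : Measure ℝ))))
      (by fun_prop)
  exact h1.inter h2

/-- The shifted Laplacian `Δ₀ + E₁` as a linear relation. -/
def shiftedLaplacian (a : ℝ) : Submodule ℝ (L2 a × L2 a) :=
  (formOperator (formDomain a)).comap
    ((LinearMap.fst ℝ _ _).prod (E1 a • LinearMap.fst ℝ _ _ - LinearMap.snd ℝ _ _))

theorem mem_shiftedLaplacian {a : ℝ} {p : L2 a × L2 a} :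
    p ∈ shiftedLaplacian a ↔ (p.1, E1 a • p.1 - p.2) ∈ formOperator (formDomain a) := Iff.rfl

theorem coe_shiftedLaplacian (a : ℝ) :
    (shiftedLaplacian a : Set (L2 a × L2 a)) = shiftedLaplacianGraph a := by
  ext p
  constructor
  · intro h
    exact ⟨E1 a • p.1 - p.2, h, by abel⟩
  · rintro ⟨f, hf, hp⟩
    rw [SetLike.mem_coe, mem_shiftedLaplacian, hp]
    have : E1 a • p.1 - (-f + E1 a • p.1) = f := by abel
    rw [this]
    exact hf

theorem isClosed_shiftedLaplacian (a : ℝ) : IsClosed (shiftedLaplacian a : Set (L2 a × L2 a)) :=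
  (isClosed_formOperator (isClosed_formDomain a)).preimage
    (f := fun p : L2 a × L2 a => (p.1, E1 a • p.1 - p.2)) (by fun_prop)

theorem isSymmetricGraph_shiftedLaplacian (a : ℝ) :
    IsSymmetricGraph (shiftedLaplacian a : Set (L2 a × L2 a)) := by
  intro p hp q hq
  have h := isSymmetricGraph_formOperator _ _ (mem_shiftedLaplacian.1 hp) _
    (mem_shiftedLaplacian.1 hq)
  simp only [inner_sub_left, inner_sub_right, real_inner_smul_left, real_inner_smul_right] at h
  linarith

theorem inner_le_of_mem_shiftedLaplacian {a : ℝ} : ∀ p ∈ shiftedLaplacian a,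
    inner ℝ p.2 p.1 ≤ E1 a * ‖p.1‖ ^ 2 := by
  intro p hp
  have h := inner_nonneg_of_mem_formOperator (mem_shiftedLaplacian.1 hp)
  simp only [inner_sub_left, real_inner_smul_left, real_inner_self_eq_norm_sq] at h
  linarith

/-! ### Limits in `L²` -/

section L2Limits

variable {α : Type*} [MeasurableSpace α] {μ : Measure α}

/-- Dominated convergence in `L²`. -/
theorem tendsto_eLpNorm_two_of_dominated {κ : Type*} {l : Filter κ} [l.IsCountablyGenerated]
    {F : κ → α → ℝ} {f B : α → ℝ} (hF : ∀ᶠ n in l, AEStronglyMeasurable (F n) μ)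
    (hf : AEStronglyMeasurable f μ) (hB : MemLp B 2 μ)
    (hFB : ∀ᶠ n in l, ∀ᵐ x ∂μ, |F n x - f x| ≤ B x)
    (hlim : ∀ᵐ x ∂μ, Tendsto (fun n => F n x) l (𝓝 (f x))) :
    Tendsto (fun n => eLpNorm (fun x => F n x - f x) 2 μ) l (𝓝 0) := by
  have hB2 : ∫⁻ x, ‖B x‖ₑ ^ (2 : ℝ) ∂μ ≠ ⊤ := by
    have := lintegral_rpow_enorm_lt_top_of_eLpNorm_lt_top (by simp) (by simp) hB.2
    simpa using this.ne
  have h : Tendsto (fun n => ∫⁻ x, ‖F n x - f x‖ₑ ^ (2 : ℝ) ∂μ) l (𝓝 (∫⁻ _, 0 ∂μ)) := by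
    refine tendsto_lintegral_filter_of_dominated_convergence' (fun x => ‖B x‖ₑ ^ (2 : ℝ)) ?_ ?_
      hB2 ?_
    · filter_upwards [hF] with n hn
      exact (hn.sub hf).enorm.pow_const _
    · filter_upwards [hFB] with n hn
      filter_upwards [hn] with x hx
      gcongr
      rw [Real.enorm_eq_ofReal_abs, Real.enorm_eq_ofReal_abs]
      exact ENNReal.ofReal_le_ofReal (hx.trans (le_abs_self _))
    · filter_upwards [hlim] with x hx
      have h1 : Tendsto (fun n => ‖F n x - f x‖ₑ ^ (2 : ℝ)) l (𝓝 (‖f x - f x‖ₑ ^ (2 : ℝ))) :=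
        (ENNReal.continuous_rpow_const.tendsto _).comp ((hx.sub_const _).enorm)
      simpa using h1
  have h2 := (ENNReal.continuous_rpow_const (y := 1 / 2)).tendsto (0 : ENNReal) |>.comp
    (by simpa using h)
  simp only [eLpNorm_eq_lintegral_rpow_enorm_toReal (two_ne_zero) (ENNReal.ofNat_ne_top)]
  simpa [Function.comp_def] using h2

/-- Differentiation of an `L²`-valued curve under pointwise differentiability and a bound of the
derivative by an `L²` function. -/
theorem hasDerivAt_of_dominated {F F' : ℝ → α → ℝ} {t₀ ε : ℝ} (hε : 0 < ε) {B : α → ℝ}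
    (hB : MemLp B 2 μ) {c : ℝ → Lp ℝ 2 μ} {c' : Lp ℝ 2 μ}
    (hc : ∀ t ∈ Metric.ball t₀ ε, c t =ᵐ[μ] F t) (hc' : c' =ᵐ[μ] F' t₀)
    (hd : ∀ x, ∀ t ∈ Metric.ball t₀ ε, HasDerivAt (fun t => F t x) (F' t x) t)
    (hbd : ∀ x, ∀ t ∈ Metric.ball t₀ ε, |F' t x| ≤ B x) : HasDerivAt c c' t₀ := by
  have h0 : t₀ ∈ Metric.ball t₀ ε := Metric.mem_ball_self hε
  have hball : ∀ᶠ t in 𝓝[≠] t₀, t ∈ Metric.ball t₀ ε :=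
    nhdsWithin_le_nhds (Metric.ball_mem_nhds _ hε)
  have hslope : ∀ t ∈ Metric.ball t₀ ε,
      slope c t₀ t =ᵐ[μ] fun x => slope (fun t => F t x) t₀ t := by
    intro t ht
    filter_upwards [Lp.coeFn_smul (t - t₀)⁻¹ (c t - c t₀), Lp.coeFn_sub (c t) (c t₀), hc t ht,
      hc t₀ h0] with x h1 h2 h3 h4
    rw [slope_def_module, h1, Pi.smul_apply, h2, Pi.sub_apply, h3, h4, slope_def_module]
  have hF : ∀ t ∈ Metric.ball t₀ ε, AEStronglyMeasurable (F t) μ := fun t ht =>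
    (Lp.aestronglyMeasurable (c t)).congr (hc t ht)
  rw [hasDerivAt_iff_tendsto_slope, Lp.tendsto_Lp_iff_tendsto_eLpNorm']
  have key := tendsto_eLpNorm_two_of_dominated (μ := μ) (l := 𝓝[≠] t₀)
    (F := fun t x => slope (fun t => F t x) t₀ t) (f := F' t₀) (B := fun x => B x + B x) ?_
    ((Lp.aestronglyMeasurable c').congr hc') (hB.add hB) ?_ ?_
  · refine key.congr' ?_
    filter_upwards [hball] with t ht
    refine eLpNorm_congr_ae ?_
    filter_upwards [hslope t ht, hc'] with x h1 h2
    rw [Pi.sub_apply, h1, h2]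
  · filter_upwards [hball] with t ht
    simp only [slope_def_module]
    exact ((hF t ht).sub (hF t₀ h0)).const_smul (t - t₀)⁻¹
  · filter_upwards [hball, self_mem_nhdsWithin] with t ht htne
    refine Eventually.of_forall fun x => (abs_sub _ _).trans (add_le_add ?_ (hbd x t₀ h0))
    have hmvt := (convex_ball t₀ ε).norm_image_sub_le_of_norm_hasDerivWithin_le
      (fun t ht => (hd x t ht).hasDerivWithinAt) (fun t ht => hbd x t ht) h0 ht
    rw [slope_def_module, smul_eq_mul, abs_mul, abs_inv, inv_mul_le_iff₀, mul_comm]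
    · exact hmvt
    · exact abs_pos.2 (sub_ne_zero.2 htne)
  · refine Eventually.of_forall fun x => ?_
    exact hasDerivAt_iff_tendsto_slope.1 (hd x t₀ h0)

end L2Limits

/-! ### Tensor products on the strip -/

theorem stripMeasure_eq_prod (a : ℝ) :
    stripMeasure a = (volume : Measure ℝ).prod (volume.restrict (Ioo (-a) a)) := by
  rw [stripMeasure, strip, Measure.volume_eq_prod, ← Measure.prod_restrict, Measure.restrict_univ]

theorem integral_tensor (a : ℝ) (g h : ℝ → ℝ) :
    ∫ x, g x.1 * h x.2 ∂stripMeasure a = (∫ x, g x) * ∫ x in Ioo (-a) a, h x := by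
  rw [stripMeasure_eq_prod, integral_prod_mul]

theorem memLp_of_continuous_Ioo (a : ℝ) {h : ℝ → ℝ} (hh : Continuous h) :
    MemLp h 2 (volume.restrict (Ioo (-a) a)) := by
  rw [memLp_two_iff_integrable_sq hh.aestronglyMeasurable]
  exact ((hh.pow 2).continuousOn.integrableOn_compact isCompact_Icc).mono_set Ioo_subset_Icc_self

theorem memLp_tensor {a : ℝ} {g h : ℝ → ℝ} (hg : MemLp g 2 volume) (hh : Continuous h) :
    MemLp (fun x : ℝ × ℝ => g x.1 * h x.2) 2 (stripMeasure a) := by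
  have hh' := memLp_of_continuous_Ioo a hh
  have hm : AEStronglyMeasurable (fun x : ℝ × ℝ => g x.1 * h x.2)
      ((volume : Measure ℝ).prod (volume.restrict (Ioo (-a) a))) :=
    hg.1.comp_fst.mul hh'.1.comp_snd
  rw [stripMeasure_eq_prod, memLp_two_iff_integrable_sq hm]
  simp only [mul_pow]
  exact hg.integrable_sq.mul_prod hh'.integrable_sq

theorem ae_mem_strip (a : ℝ) : ∀ᵐ x ∂stripMeasure a, x ∈ strip a :=
  ae_restrict_mem (MeasurableSet.univ.prod measurableSet_Ioo)

open Classical in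
/-- The class in `L²(Ω)` of a function; by convention `0` if it is not square integrable. -/
def toL2 (a : ℝ) (f : ℝ × ℝ → ℝ) : L2 a :=
  if h : MemLp f 2 (stripMeasure a) then h.toLp f else 0

theorem toL2_ae_eq {a : ℝ} {f : ℝ × ℝ → ℝ} (hf : MemLp f 2 (stripMeasure a)) :
    toL2 a f =ᵐ[stripMeasure a] f := by
  rw [toL2, dif_pos hf]
  exact hf.coeFn_toLp

theorem inner_eq_integral {α : Type*} [MeasurableSpace α] {μ : Measure α} {u v : Lp ℝ 2 μ}
    {f g : α → ℝ} (hu : u =ᵐ[μ] f) (hv : v =ᵐ[μ] g) : inner ℝ u v = ∫ x, f x * g x ∂μ := by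
  rw [L2.inner_def]
  refine integral_congr_ae ?_
  filter_upwards [hu, hv] with x h1 h2
  rw [h1, h2]
  exact mul_comm _ _

theorem partial1_tensor {g h : ℝ → ℝ} (hg : Differentiable ℝ g) (hh : Differentiable ℝ h)
    (x : ℝ × ℝ) : partial1 (fun x => g x.1 * h x.2) x = deriv g x.1 * h x.2 := by
  have h1 := ((hg x.1).hasDerivAt.hasFDerivAt.comp x hasFDerivAt_fst).mul
    ((hh x.2).hasDerivAt.hasFDerivAt.comp x hasFDerivAt_snd)
  rw [partial1]
  erw [h1.fderiv]
  simp [mul_comm]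

theorem partial2_tensor {g h : ℝ → ℝ} (hg : Differentiable ℝ g) (hh : Differentiable ℝ h)
    (x : ℝ × ℝ) : partial2 (fun x => g x.1 * h x.2) x = g x.1 * deriv h x.2 := by
  have h1 := ((hg x.1).hasDerivAt.hasFDerivAt.comp x hasFDerivAt_fst).mul
    ((hh x.2).hasDerivAt.hasFDerivAt.comp x hasFDerivAt_snd)
  rw [partial2]
  erw [h1.fderiv]
  simp [mul_comm]

theorem partial1_eq_deriv {φ : ℝ × ℝ → ℝ} (hφ : Differentiable ℝ φ) (s b : ℝ) :
    HasDerivAt (fun s => φ (s, b)) (partial1 φ (s, b)) s :=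
  (hφ (s, b)).hasFDerivAt.comp_hasDerivAt s ((hasDerivAt_id s).prodMk (hasDerivAt_const s b))

theorem partial2_eq_deriv {φ : ℝ × ℝ → ℝ} (hφ : Differentiable ℝ φ) (s b : ℝ) :
    HasDerivAt (fun b => φ (s, b)) (partial2 φ (s, b)) b :=
  (hφ (s, b)).hasFDerivAt.comp_hasDerivAt b ((hasDerivAt_const b s).prodMk (hasDerivAt_id b))

theorem integrable_mul_of_continuous {a : ℝ} {w ψ : ℝ × ℝ → ℝ} (hw : Continuous w)
    (hψ : Continuous ψ) (hψ' : HasCompactSupport ψ) :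
    Integrable (fun x => w x * ψ x) (stripMeasure a) :=
  (hw.mul hψ).integrable_of_hasCompactSupport hψ'.mul_left

/-! ### Product functions in the operator domain -/

/-- Integration by parts in `x₁`. -/
theorem integral_tensor_mul_partial1 {a : ℝ} {g g' h : ℝ → ℝ} (hg : ∀ x, HasDerivAt g (g' x) x)
    (hg' : Continuous g') (hh : Continuous h) (φ : testFunctions) :
    ∫ x, g x.1 * h x.2 * partial1 φ.1 x ∂stripMeasure a
      = -∫ x, g' x.1 * h x.2 * φ.1 x ∂stripMeasure a := by
  have hgc : Continuous g := continuous_iff_continuousAt.2 fun x => (hg x).continuousAt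
  have hφ1 := (contDiff_partial1 φ.2.1).continuous
  have hφ1' := hasCompactSupport_partial1 φ.2.2
  have i1 := integrable_mul_of_continuous (a := a) (w := fun x => g x.1 * h x.2)
    (by fun_prop) hφ1 hφ1'
  have i2 := integrable_mul_of_continuous (a := a) (w := fun x => g' x.1 * h x.2)
    (by fun_prop) φ.2.1.continuous φ.2.2
  rw [stripMeasure_eq_prod] at *
  rw [integral_prod_symm _ i1, integral_prod_symm _ i2, ← integral_neg]
  refine integral_congr_ae (Eventually.of_forall fun b => ?_)
  have key := integral_mul_deriv_eq_deriv_mul_of_integrable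
    (u := g) (v := fun s => φ.1 (s, b)) (u' := g') (v' := fun s => partial1 φ.1 (s, b))
    (fun x _ => hg x) (fun x _ => partial1_eq_deriv (φ.2.1.differentiable (by simp)) x b)
    ((hgc.mul (hφ1.comp (by fun_prop))).integrable_of_hasCompactSupport
      (hasCompactSupport_slice hφ1' b).mul_left)
    ((hg'.mul (φ.2.1.continuous.comp (by fun_prop))).integrable_of_hasCompactSupport
      (hasCompactSupport_slice φ.2.2 b).mul_left)
    ((hgc.mul (φ.2.1.continuous.comp (by fun_prop))).integrable_of_hasCompactSupport
      (hasCompactSupport_slice φ.2.2 b).mul_left)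
  simp only [mul_right_comm _ (h b), integral_mul_const, key, neg_mul]

/-- Integration by parts in `x₂`, with the boundary term on the lower line. -/
theorem integral_tensor_mul_partial2 {a : ℝ} (ha : 0 < a) {g h h' : ℝ → ℝ} (hg : Continuous g)
    (hh : ∀ x, HasDerivAt h (h' x) x) (hh' : Continuous h') (φ : testFunctions)
    (hN : ∀ s, h a * φ.1 (s, a) = 0) :
    ∫ x, g x.1 * h x.2 * partial2 φ.1 x ∂stripMeasure a
      = -(∫ x, g x.1 * h' x.2 * φ.1 x ∂stripMeasure a) - h (-a) * ∫ s, g s * φ.1 (s, -a) := by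
  have hhc : Continuous h := continuous_iff_continuousAt.2 fun x => (hh x).continuousAt
  have hφ2 := (contDiff_partial2 φ.2.1).continuous
  have hφ2' := hasCompactSupport_partial2 φ.2.2
  have i1 := integrable_mul_of_continuous (a := a) (w := fun x => g x.1 * h x.2)
    (by fun_prop) hφ2 hφ2'
  have i2 := integrable_mul_of_continuous (a := a) (w := fun x => g x.1 * h' x.2)
    (by fun_prop) φ.2.1.continuous φ.2.2
  have i3 : Integrable fun s => g s * φ.1 (s, -a) :=
    (hg.mul (φ.2.1.continuous.comp (by fun_prop))).integrable_of_hasCompactSupport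
      (hasCompactSupport_slice φ.2.2 (-a)).mul_left
  rw [stripMeasure_eq_prod] at *
  have i4 : Integrable fun s => -∫ b in Ioo (-a) a, g (s, b).1 * h' (s, b).2 * φ.1 (s, b) :=
    i2.integral_prod_left.neg
  rw [integral_prod _ i1, integral_prod _ i2, ← integral_const_mul, ← integral_neg,
    ← integral_sub i4 (i3.const_mul _)]
  refine integral_congr_ae (Eventually.of_forall fun s => ?_)
  have key := intervalIntegral.integral_mul_deriv_eq_deriv_mul (a := -a) (b := a)
    (u := h) (v := fun b => φ.1 (s, b)) (u' := h') (v' := fun b => partial2 φ.1 (s, b))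
    (fun x _ => hh x) (fun x _ => partial2_eq_deriv (φ.2.1.differentiable (by simp)) s x)
    (hh'.intervalIntegrable _ _) ((hφ2.comp (by fun_prop)).intervalIntegrable _ _)
  simp only [intervalIntegral.integral_of_le (show -a ≤ a by linarith),
    integral_Ioc_eq_integral_Ioo, hN] at key
  simp only [mul_assoc, integral_const_mul, key]
  ring

/-- A product `g ⊗ h` of smooth functions, with `g` and its derivative square integrable and
`h (-a) = 0`, belongs to the form domain; the approximating test functions are cut-offs. -/
theorem mem_formDomain_tensor {a : ℝ} (ha : 0 < a) {g g' h h' : ℝ → ℝ} (hg : ContDiff ℝ ∞ g)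
    (hh : ContDiff ℝ ∞ h) (hg' : ∀ x, HasDerivAt g (g' x) x) (hh' : ∀ x, HasDerivAt h (h' x) x)
    (hg2 : MemLp g 2 volume) (hg2' : MemLp g' 2 volume) (hD : h (-a) = 0) :
    (toL2 a fun x => g x.1 * h x.2, toL2 a fun x => g' x.1 * h x.2,
      toL2 a fun x => g x.1 * h' x.2) ∈ formDomain a := by
  have eg : g' = deriv g := funext fun x => (hg' x).deriv.symm
  have eh : h' = deriv h := funext fun x => (hh' x).deriv.symm
  have hgc' : ContDiff ℝ ∞ g' := eg ▸ hg.deriv'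
  have hhc' : ContDiff ℝ ∞ h' := eh ▸ hh.deriv'
  let U : ℝ × ℝ → ℝ := fun x => g x.1 * h x.2
  have hU : ContDiff ℝ ∞ U := (hg.comp contDiff_fst).mul (hh.comp contDiff_snd)
  have m0 : MemLp U 2 (stripMeasure a) := memLp_tensor hg2 hh.continuous
  have m1 : MemLp (fun x : ℝ × ℝ => g' x.1 * h x.2) 2 (stripMeasure a) :=
    memLp_tensor hg2' hh.continuous
  have m2 : MemLp (fun x : ℝ × ℝ => g x.1 * h' x.2) 2 (stripMeasure a) :=
    memLp_tensor hg2 hhc'.continuous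
  have d1 : ∀ x, partial1 U x = g' x.1 * h x.2 := fun x => by
    rw [partial1_tensor (hg.differentiable (by simp)) (hh.differentiable (by simp)), eg]
  have d2 : ∀ x, partial2 U x = g x.1 * h' x.2 := fun x => by
    rw [partial2_tensor (hg.differentiable (by simp)) (hh.differentiable (by simp)), eh]
  refine ⟨?_, ?_⟩
  · intro φ hφ hφc hφs
    have hb : ∀ s b, b ∉ Ioo (-a) a → φ (s, b) = 0 := fun s b hb =>
      image_eq_zero_of_notMem_tsupport fun h => hb (hφs h).2
    let φ' : testFunctions := ⟨φ, hφ, hφc⟩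
    have e : ∀ {f : ℝ × ℝ → ℝ} (_ : MemLp f 2 (stripMeasure a)) (ψ : ℝ × ℝ → ℝ),
        ∫ x, toL2 a f x * ψ x ∂stripMeasure a = ∫ x, f x * ψ x ∂stripMeasure a := by
      intro f hf ψ
      refine integral_congr_ae ?_
      filter_upwards [toL2_ae_eq hf] with x hx
      rw [hx]
    constructor
    · rw [e m0, e m1]
      exact integral_tensor_mul_partial1 hg' hgc'.continuous hh.continuous φ'
    · rw [e m0, e m2]
      have := integral_tensor_mul_partial2 ha hg.continuous hh' hhc'.continuous φ'
        fun s => by simp [φ', hb s a (by simp)]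
      simpa [φ', hb _ (-a) (by simp)] using this
  · obtain ⟨ψ⟩ : Nonempty (ContDiffBump (0 : ℝ × ℝ)) := ⟨⟨1, 2, one_pos, one_lt_two⟩⟩
    have hψ : ContDiff ℝ ∞ ψ := ψ.contDiff
    have hψc : HasCompactSupport ψ := ψ.hasCompactSupport
    -- The cut-offs `x ↦ ψ (r x)` as `r → 0`.
    let r : ℕ → ℝ := fun n => 1 / ((n : ℝ) + 1)
    have hr : Tendsto r atTop (𝓝 0) := tendsto_one_div_add_atTop_nhds_zero_nat
    have hr0 : ∀ n, 0 < r n := fun n => Nat.one_div_pos_of_nat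
    have hr1 : ∀ n, r n ≤ 1 := fun n => by
      simp only [r]
      rw [div_le_one (by positivity)]
      simp
    let χ : ℕ → ℝ × ℝ → ℝ := fun n x => ψ (r n • x)
    have hχ : ∀ n, ContDiff ℝ ∞ (χ n) := fun n => hψ.comp (contDiff_const_smul (r n))
    have hχc : ∀ n, HasCompactSupport (χ n) := fun n => hψc.comp_smul (hr0 n).ne'
    have hχ01 : ∀ n x, |χ n x - 1| ≤ 1 := fun n x => by
      have h1 := ψ.nonneg (x := r n • x)
      have h2 := ψ.le_one (x := r n • x)
      rw [abs_le]
      constructor <;> simp only [χ] <;> linarith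
    have hχlim : ∀ x, Tendsto (fun n => χ n x) atTop (𝓝 1) := fun x => by
      have h1 : Tendsto (fun n => r n • x) atTop (𝓝 0) := by simpa using hr.smul_const x
      have h2 := (hψ.continuous.tendsto 0).comp h1
      have h3 : ψ (0 : ℝ × ℝ) = 1 := ψ.one_of_mem_closedBall (by simp [ψ.rIn_pos.le])
      rwa [h3] at h2
    -- A product rule for the directional derivatives, with a bound for the error term.
    have hprod : ∀ v : ℝ × ℝ, ∃ M, ∃ E : ℕ → ℝ × ℝ → ℝ,
        (∀ n x, fderiv ℝ (fun x => χ n x * U x) x v = χ n x * fderiv ℝ U x v + E n x * U x) ∧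
        (∀ n x, |E n x| ≤ M) ∧ ∀ x, Tendsto (fun n => E n x) atTop (𝓝 0) := by
      intro v
      have hcont : Continuous fun x => fderiv ℝ ψ x v :=
        (hψ.continuous_fderiv (by simp)).clm_apply continuous_const
      obtain ⟨M, hM⟩ := hcont.bounded_above_of_compact_support (hψc.fderiv_apply ℝ v)
      have hb : ∀ n x, |r n * fderiv ℝ ψ (r n • x) v| ≤ r n * M := fun n x => by
        rw [abs_mul, abs_of_pos (hr0 n)]
        exact mul_le_mul_of_nonneg_left (hM _) (hr0 n).le
      have hM0 : 0 ≤ M := (norm_nonneg _).trans (hM 0)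
      refine ⟨M, fun n x => r n * fderiv ℝ ψ (r n • x) v, fun n x => ?_, fun n x =>
        (hb n x).trans (mul_le_of_le_one_left hM0 (hr1 n)), fun x => ?_⟩
      · have h1 : HasFDerivAt (χ n) (r n • fderiv ℝ ψ (r n • x)) x := by
          have := ((hψ.differentiable (by simp)) (r n • x)).hasFDerivAt.comp x
            ((hasFDerivAt_id x).const_smul (r n))
          refine this.congr_fderiv ?_
          ext <;> simp
        have h2 := (hU.differentiable (by simp) x).hasFDerivAt
        erw [(h1.mul h2).fderiv]
        simp only [add_apply, smul_apply, smul_eq_mul]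
        ring
      · refine squeeze_zero_norm (fun n => hb n x) ?_
        simpa using hr.mul_const M
    -- Each of the three sequences converges by domination.
    have hconv : ∀ {w : ℝ × ℝ → ℝ} {W : L2 a} {E : ℕ → ℝ × ℝ → ℝ} {M : ℝ},
        MemLp w 2 (stripMeasure a) → W =ᵐ[stripMeasure a] w →
        (∀ n, Continuous fun x => χ n x * w x + E n x * U x) → (∀ n x, |E n x| ≤ M) →
        (∀ x, Tendsto (fun n => E n x) atTop (𝓝 0)) →
        Tendsto (fun n => eLpNorm (fun x => (χ n x * w x + E n x * U x) - W x) 2 (stripMeasure a))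
          atTop (𝓝 0) := by
      intro w W E M hw hW hc hE hE0
      refine (tendsto_eLpNorm_two_of_dominated (μ := stripMeasure a) (l := atTop) (f := w)
        (F := fun n x => χ n x * w x + E n x * U x)
        (B := fun x => |w x| + M * |U x|) ?_ hw.1 (hw.abs.add (m0.abs.const_mul M)) ?_ ?_).congr
        fun n => ?_
      · exact Eventually.of_forall fun n => (hc n).aestronglyMeasurable
      · refine Eventually.of_forall fun n => Eventually.of_forall fun x => ?_
        have : χ n x * w x + E n x * U x - w x = (χ n x - 1) * w x + E n x * U x := by ring
        rw [this]
        refine (abs_add_le _ _).trans (add_le_add ?_ ?_)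
        · rw [abs_mul]
          exact mul_le_of_le_one_left (abs_nonneg _) (hχ01 n x)
        · rw [abs_mul]
          exact mul_le_mul_of_nonneg_right (hE n x) (abs_nonneg _)
      · refine Eventually.of_forall fun x => ?_
        simpa using ((hχlim x).mul_const (w x)).add ((hE0 x).mul_const (U x))
      · refine eLpNorm_congr_ae ?_
        filter_upwards [hW] with x hx
        rw [hx]
    have hφ : ∀ n, ContDiff ℝ ∞ fun x => χ n x * U x := fun n => (hχ n).mul hU
    refine ⟨fun n x => χ n x * U x, fun n => ⟨hφ n, (hχc n).mul_right⟩, ?_, ?_, ?_, ?_⟩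
    · have := hconv (E := fun _ _ => 0) (M := 0) m0 (toL2_ae_eq m0)
        (fun n => by simpa using (hφ n).continuous) (by simp) (by simp)
      simpa using this
    · obtain ⟨M, E, h1, h2, h3⟩ := hprod (1, 0)
      have h1' : ∀ n x, partial1 (fun x => χ n x * U x) x
          = χ n x * (g' x.1 * h x.2) + E n x * U x := fun n x => by rw [← d1]; exact h1 n x
      simp only [h1']
      refine hconv m1 (toL2_ae_eq m1) (fun n => ?_) h2 h3
      simpa only [← h1'] using (contDiff_partial1 (hφ n)).continuous
    · obtain ⟨M, E, h1, h2, h3⟩ := hprod (0, 1)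
      have h1' : ∀ n x, partial2 (fun x => χ n x * U x) x
          = χ n x * (g x.1 * h' x.2) + E n x * U x := fun n x => by rw [← d2]; exact h1 n x
      simp only [h1']
      refine hconv m2 (toL2_ae_eq m2) (fun n => ?_) h2 h3
      simpa only [← h1'] using (contDiff_partial2 (hφ n)).continuous
    · have h0 : ∀ n, eLpNorm (fun s : ℝ => χ n (s, -a) * U (s, -a)
          - (0 : Lp ℝ 2 (volume : Measure ℝ)) s) 2 volume = 0 := by
        intro n
        refine (eLpNorm_congr_ae ?_).trans eLpNorm_zero
        exact Eventually.of_forall fun s => by simp [U, hD]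
      simp only [h0, tendsto_const_nhds]

/-- A product `g ⊗ h` of smooth functions satisfying the boundary conditions `h (-a) = 0` and
`h' a = 0` belongs to the domain of the operator, which acts on it as `-Δ`. -/
theorem mem_formOperator_tensor {a : ℝ} (ha : 0 < a) {g g' g'' h h' h'' : ℝ → ℝ}
    (hg : ContDiff ℝ ∞ g) (hh : ContDiff ℝ ∞ h) (hg' : ∀ x, HasDerivAt g (g' x) x)
    (hg'' : ∀ x, HasDerivAt g' (g'' x) x) (hh' : ∀ x, HasDerivAt h (h' x) x)
    (hh'' : ∀ x, HasDerivAt h' (h'' x) x)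
    (hg2 : MemLp g 2 volume) (hg2' : MemLp g' 2 volume) (hg2'' : MemLp g'' 2 volume)
    (hD : h (-a) = 0) (hN : h' a = 0) :
    (toL2 a fun x => g x.1 * h x.2, toL2 a fun x => -(g'' x.1 * h x.2 + g x.1 * h'' x.2))
      ∈ formOperator (formDomain a) := by
  have eg : g' = deriv g := funext fun x => (hg' x).deriv.symm
  have eh : h' = deriv h := funext fun x => (hh' x).deriv.symm
  have eg' : g'' = deriv g' := funext fun x => (hg'' x).deriv.symm
  have eh' : h'' = deriv h' := funext fun x => (hh'' x).deriv.symm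
  have cg' : ContDiff ℝ ∞ g' := eg ▸ hg.deriv'
  have ch' : ContDiff ℝ ∞ h' := eh ▸ hh.deriv'
  have cg'' : Continuous g'' := (eg' ▸ cg'.deriv' : ContDiff ℝ ∞ g'').continuous
  have ch'' : Continuous h'' := (eh' ▸ ch'.deriv' : ContDiff ℝ ∞ h'').continuous
  have m1 : MemLp (fun x : ℝ × ℝ => g' x.1 * h x.2) 2 (stripMeasure a) :=
    memLp_tensor hg2' hh.continuous
  have m2 : MemLp (fun x : ℝ × ℝ => g x.1 * h' x.2) 2 (stripMeasure a) :=
    memLp_tensor hg2 ch'.continuous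
  have m3 : MemLp (fun x : ℝ × ℝ => -(g'' x.1 * h x.2 + g x.1 * h'' x.2)) 2 (stripMeasure a) :=
    ((memLp_tensor hg2'' hh.continuous).add (memLp_tensor hg2 ch'')).neg
  refine ⟨_, _, mem_formDomain_tensor ha hg hh hg' hh' hg2 hg2' hD, fun v k₁ k₂ hv => ?_⟩
  have hv := hasLowerTrace_iff.1 hv.2
  -- The identity is extended by continuity from test functions, with a boundary term.
  let L : L2 a × L2 a × L2 a × Lp ℝ 2 (volume : Measure ℝ) → ℝ := fun p =>
    inner ℝ (toL2 a fun x => g' x.1 * h x.2) p.2.1 + inner ℝ (toL2 a fun x => g x.1 * h' x.2) p.2.2.1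
      + h' (-a) * inner ℝ hg2.toLp p.2.2.2
      - inner ℝ (toL2 a fun x => -(g'' x.1 * h x.2 + g x.1 * h'' x.2)) p.1
  have hL : IsClosed {p | L p = 0} := isClosed_eq (by fun_prop) continuous_const
  have hsub : (LinearMap.range (testGraph a) : Set _) ⊆ {p | L p = 0} := by
    rintro _ ⟨φ, rfl⟩
    have e1 := inner_eq_integral (toL2_ae_eq m1) (testFunctions.memLp_partial1 φ a).coeFn_toLp
    have e2 := inner_eq_integral (toL2_ae_eq m2) (testFunctions.memLp_partial2 φ a).coeFn_toLp
    have e3 := inner_eq_integral (toL2_ae_eq m3) (testFunctions.memLp φ a).coeFn_toLp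
    have e4 := inner_eq_integral hg2.coeFn_toLp (testFunctions.memLp_slice φ a).coeFn_toLp
    have b1 := integral_tensor_mul_partial1 (a := a) hg'' cg'' hh.continuous φ
    have b2 := integral_tensor_mul_partial2 ha hg.continuous hh'' ch'' φ fun s => by simp [hN]
    have i1 := integrable_mul_of_continuous (a := a) (w := fun x => g'' x.1 * h x.2)
      (cg''.comp continuous_fst |>.mul (hh.continuous.comp continuous_snd)) φ.2.1.continuous φ.2.2
    have i2 := integrable_mul_of_continuous (a := a) (w := fun x => g x.1 * h'' x.2)
      (hg.continuous.comp continuous_fst |>.mul (ch''.comp continuous_snd)) φ.2.1.continuous φ.2.2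
    have e5 : ∫ x, -(g'' x.1 * h x.2 + g x.1 * h'' x.2) * φ.1 x ∂stripMeasure a
        = -(∫ x, g'' x.1 * h x.2 * φ.1 x ∂stripMeasure a)
          - ∫ x, g x.1 * h'' x.2 * φ.1 x ∂stripMeasure a := by
      rw [neg_sub_left, add_comm, ← integral_add i1 i2, ← integral_neg]
      refine integral_congr_ae (Eventually.of_forall fun x => ?_)
      simp only
      ring
    change inner ℝ _ (testFunctions.memLp_partial1 φ a).toLp
      + inner ℝ _ (testFunctions.memLp_partial2 φ a).toLp
      + h' (-a) * inner ℝ _ (testFunctions.memLp_slice φ a).toLp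
      - inner ℝ _ (testFunctions.memLp φ a).toLp = 0
    rw [e1, e2, e3, e4, e5, b1, b2]
    ring
  have := hL.closure_subset_iff.2 hsub hv
  simp only [L, mem_ofPred_eq, inner_zero_right, mul_zero, add_zero] at this
  linarith

/-! ### Gaussians -/

/-- The one-dimensional heat kernel `s^{-1/2} exp (-x² / (4s))`, up to the factor `(4π)^{-1/2}`. -/
def gauss (s x : ℝ) : ℝ := (√s)⁻¹ * Real.exp (-x ^ 2 / (4 * s))

/-- The derivative of `gauss` in `x`. -/
def gaussDeriv (s x : ℝ) : ℝ := -(x / (2 * s)) * gauss s x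

/-- The second derivative of `gauss` in `x`, which is also its derivative in `s`. -/
def gaussDeriv2 (s x : ℝ) : ℝ := (x ^ 2 / (4 * s ^ 2) - 1 / (2 * s)) * gauss s x

theorem contDiff_gauss (s : ℝ) : ContDiff ℝ ∞ (gauss s) := by
  unfold gauss; fun_prop

theorem hasDerivAt_gauss {s : ℝ} (hs : 0 < s) (x : ℝ) :
    HasDerivAt (gauss s) (gaussDeriv s x) x := by
  have h : HasDerivAt (fun x : ℝ => -x ^ 2 / (4 * s)) (-(x / (2 * s))) x := by
    refine (((hasDerivAt_id x).pow 2).neg.div_const (4 * s)).congr_deriv ?_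
    simp only [id]
    field_simp
    norm_num
    ring
  refine (h.exp.const_mul (√s)⁻¹).congr_deriv ?_
  rw [gaussDeriv, gauss]
  ring

theorem hasDerivAt_gaussDeriv {s : ℝ} (hs : 0 < s) (x : ℝ) :
    HasDerivAt (gaussDeriv s) (gaussDeriv2 s x) x := by
  refine ((((hasDerivAt_id x).div_const (2 * s)).neg).mul (hasDerivAt_gauss hs x)).congr_deriv ?_
  simp only [gaussDeriv2, gaussDeriv, id, Pi.neg_apply]
  field_simp
  ring

theorem hasDerivAt_gauss_time {s : ℝ} (hs : 0 < s) (x : ℝ) :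
    HasDerivAt (fun s => gauss s x) (gaussDeriv2 s x) s := by
  have h1 : HasDerivAt (fun s : ℝ => -x ^ 2 / (4 * s)) (x ^ 2 / (4 * s ^ 2)) s := by
    refine ((hasDerivAt_const s (-x ^ 2)).div ((hasDerivAt_id s).const_mul 4)
      (by simpa using hs.ne')).congr_deriv ?_
    simp only [id]
    field_simp
    ring
  have h2 := (Real.hasDerivAt_sqrt hs.ne').inv (Real.sqrt_pos.2 hs).ne'
  refine (h2.mul h1.exp).congr_deriv ?_
  have h3 : √s ^ 2 = s := Real.sq_sqrt hs.le
  have h4 := (Real.sqrt_pos.2 hs).ne'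
  rw [gaussDeriv2, gauss]
  simp only [h3, Pi.inv_apply]
  field_simp
  ring

theorem gauss_nonneg (s x : ℝ) : 0 ≤ gauss s x := by unfold gauss; positivity

theorem sq_mul_exp_le {s : ℝ} (hs : 0 < s) (x : ℝ) :
    x ^ 2 * Real.exp (-x ^ 2 / (4 * s)) ≤ 8 * s * Real.exp (-x ^ 2 / (8 * s)) := by
  have h1 : x ^ 2 / (8 * s) ≤ Real.exp (x ^ 2 / (8 * s)) := by
    linarith [Real.add_one_le_exp (x ^ 2 / (8 * s))]
  have h2 : Real.exp (-x ^ 2 / (8 * s))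
      = Real.exp (x ^ 2 / (8 * s)) * Real.exp (-x ^ 2 / (4 * s)) := by
    rw [← Real.exp_add]
    congr 1
    field_simp
    ring
  rw [div_le_iff₀ (by positivity)] at h1
  rw [h2, ← mul_assoc]
  gcongr
  linarith

theorem exp_le_exp_wider {s : ℝ} (hs : 0 < s) (x : ℝ) :
    Real.exp (-x ^ 2 / (4 * s)) ≤ Real.exp (-x ^ 2 / (8 * s)) := by
  rw [Real.exp_le_exp, neg_div, neg_div, neg_le_neg_iff]
  gcongr
  norm_num

theorem abs_gaussDeriv_le {s : ℝ} (hs : 0 < s) (x : ℝ) :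
    |gaussDeriv s x| ≤ (1 + 2 / s) * (√s)⁻¹ * Real.exp (-x ^ 2 / (8 * s)) := by
  have h0 : |x / (2 * s)| ≤ 1 + x ^ 2 / (4 * s ^ 2) := by
    have : x ^ 2 / (4 * s ^ 2) = |x / (2 * s)| ^ 2 := by rw [sq_abs]; ring
    rw [this]
    nlinarith [sq_nonneg (|x / (2 * s)| - 1)]
  rw [gaussDeriv, gauss, abs_mul, abs_neg, abs_of_nonneg (a := _ * Real.exp _) (by positivity)]
  have h1 := sq_mul_exp_le hs x
  have h2 := exp_le_exp_wider hs x
  have h3 : x ^ 2 / (4 * s ^ 2) * Real.exp (-x ^ 2 / (4 * s))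
      ≤ 2 / s * Real.exp (-x ^ 2 / (8 * s)) := by
    calc _ = 1 / (4 * s ^ 2) * (x ^ 2 * Real.exp (-x ^ 2 / (4 * s))) := by ring
      _ ≤ 1 / (4 * s ^ 2) * (8 * s * Real.exp (-x ^ 2 / (8 * s))) := by gcongr
      _ = _ := by field_simp; norm_num
  calc |x / (2 * s)| * ((√s)⁻¹ * Real.exp (-x ^ 2 / (4 * s)))
      ≤ (1 + x ^ 2 / (4 * s ^ 2)) * ((√s)⁻¹ * Real.exp (-x ^ 2 / (4 * s))) := by gcongr
    _ = (√s)⁻¹ * (Real.exp (-x ^ 2 / (4 * s))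
        + x ^ 2 / (4 * s ^ 2) * Real.exp (-x ^ 2 / (4 * s))) := by ring
    _ ≤ (√s)⁻¹ * (Real.exp (-x ^ 2 / (8 * s)) + 2 / s * Real.exp (-x ^ 2 / (8 * s))) := by gcongr
    _ = _ := by ring

theorem abs_gaussDeriv2_le {s : ℝ} (hs : 0 < s) (x : ℝ) :
    |gaussDeriv2 s x| ≤ 3 / s * (√s)⁻¹ * Real.exp (-x ^ 2 / (8 * s)) := by
  rw [gaussDeriv2, gauss, abs_mul, abs_of_nonneg (a := _ * Real.exp _) (by positivity)]
  have h1 := sq_mul_exp_le hs x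
  have h2 := exp_le_exp_wider hs x
  have h0 : |x ^ 2 / (4 * s ^ 2) - 1 / (2 * s)| ≤ x ^ 2 / (4 * s ^ 2) + 1 / (2 * s) := by
    refine (abs_sub _ _).trans_eq ?_
    rw [abs_of_nonneg (by positivity), abs_of_nonneg (by positivity)]
  have h3 : x ^ 2 / (4 * s ^ 2) * Real.exp (-x ^ 2 / (4 * s))
      ≤ 2 / s * Real.exp (-x ^ 2 / (8 * s)) := by
    calc _ = 1 / (4 * s ^ 2) * (x ^ 2 * Real.exp (-x ^ 2 / (4 * s))) := by ring
      _ ≤ 1 / (4 * s ^ 2) * (8 * s * Real.exp (-x ^ 2 / (8 * s))) := by gcongr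
      _ = _ := by field_simp; norm_num
  have h4 : 1 / (2 * s) ≤ 1 / s := by gcongr; linarith
  calc |x ^ 2 / (4 * s ^ 2) - 1 / (2 * s)| * ((√s)⁻¹ * Real.exp (-x ^ 2 / (4 * s)))
      ≤ (x ^ 2 / (4 * s ^ 2) + 1 / (2 * s)) * ((√s)⁻¹ * Real.exp (-x ^ 2 / (4 * s))) := by gcongr
    _ = (√s)⁻¹ * (x ^ 2 / (4 * s ^ 2) * Real.exp (-x ^ 2 / (4 * s))
        + 1 / (2 * s) * Real.exp (-x ^ 2 / (4 * s))) := by ring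
    _ ≤ (√s)⁻¹ * (2 / s * Real.exp (-x ^ 2 / (8 * s)) + 1 / s * Real.exp (-x ^ 2 / (8 * s))) := by
        gcongr
    _ = _ := by ring

theorem memLp_exp_neg_sq {b : ℝ} (hb : 0 < b) (y : ℝ) :
    MemLp (fun x : ℝ => Real.exp (-(x - y) ^ 2 / b)) 2 volume := by
  rw [memLp_two_iff_integrable_sq (by fun_prop)]
  have h := (integrable_exp_neg_mul_sq (b := 2 / b) (by positivity)).comp_sub_right y
  refine h.congr (Eventually.of_forall fun x => ?_)
  simp only
  rw [← Real.exp_nat_mul]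
  congr 1
  push_cast
  ring

theorem memLp_gauss {s : ℝ} (hs : 0 < s) (y : ℝ) :
    MemLp (fun x => gauss s (x - y)) 2 volume :=
  (memLp_exp_neg_sq (b := 4 * s) (by positivity) y).const_mul (√s)⁻¹

theorem memLp_gaussDeriv {s : ℝ} (hs : 0 < s) (y : ℝ) :
    MemLp (fun x => gaussDeriv s (x - y)) 2 volume := by
  refine ((memLp_exp_neg_sq (b := 8 * s) (by positivity) y).const_mul
    ((1 + 2 / s) * (√s)⁻¹)).mono' ?_ (Eventually.of_forall fun x => abs_gaussDeriv_le hs _)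
  unfold gaussDeriv gauss; fun_prop

theorem memLp_gaussDeriv2 {s : ℝ} (hs : 0 < s) (y : ℝ) :
    MemLp (fun x => gaussDeriv2 s (x - y)) 2 volume := by
  refine ((memLp_exp_neg_sq (b := 8 * s) (by positivity) y).const_mul
    (3 / s * (√s)⁻¹)).mono' ?_ (Eventually.of_forall fun x => abs_gaussDeriv2_le hs _)
  unfold gaussDeriv2 gauss; fun_prop

/-! ### Transversal modes -/

/-- The frequency of the `n`-th transversal mode. -/
def freq (a : ℝ) (n : ℕ) : ℝ := (2 * n + 1) * (Real.pi / (4 * a))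

/-- The `n`-th eigenfunction of `-d²/dx₂²` on `(-a, a)`, Dirichlet at `-a` and Neumann at `a`. -/
def mode (a : ℝ) (n : ℕ) (b : ℝ) : ℝ := Real.sin (freq a n * (b + a))

/-- The derivative of `mode`. -/
def modeDeriv (a : ℝ) (n : ℕ) (b : ℝ) : ℝ := freq a n * Real.cos (freq a n * (b + a))

theorem contDiff_mode (a : ℝ) (n : ℕ) : ContDiff ℝ ∞ (mode a n) := by
  unfold mode; fun_prop

theorem hasDerivAt_mode (a : ℝ) (n : ℕ) (b : ℝ) :
    HasDerivAt (mode a n) (modeDeriv a n b) b := by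
  refine ((((hasDerivAt_id b).add_const a).const_mul (freq a n)).sin).congr_deriv ?_
  simp [modeDeriv, mul_comm]

theorem hasDerivAt_modeDeriv (a : ℝ) (n : ℕ) (b : ℝ) :
    HasDerivAt (modeDeriv a n) (-freq a n ^ 2 * mode a n b) b := by
  refine (((((hasDerivAt_id b).add_const a).const_mul (freq a n)).cos).const_mul
    (freq a n)).congr_deriv ?_
  simp only [mode, id]
  ring

theorem mode_neg_self (a : ℝ) (n : ℕ) : mode a n (-a) = 0 := by simp [mode]

theorem modeDeriv_self {a : ℝ} (ha : 0 < a) (n : ℕ) : modeDeriv a n a = 0 := by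
  have : freq a n * (a + a) = n * Real.pi + Real.pi / 2 := by
    rw [freq]
    field_simp
    ring
  rw [modeDeriv, this, Real.cos_add_pi_div_two, Real.sin_nat_mul_pi]
  simp

theorem abs_mode_le (a : ℝ) (n : ℕ) (b : ℝ) : |mode a n b| ≤ 1 := Real.abs_sin_le_one _

/-! ### Wave packets and their heat flow -/

/-- The data of a Gaussian wave packet: a transversal mode `n`, a width `s > 0` and a centre `y`. -/
structure WavePacket where
  n : ℕ
  s : ℝ
  s_pos : 0 < s
  y : ℝ

namespace WavePacket

/-- The longitudinal factor at time `t` of the heat flow of a wave packet. -/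
def longitudinal (a : ℝ) (i : WavePacket) (t x : ℝ) : ℝ :=
  Real.exp ((E1 a - freq a i.n ^ 2) * t) * gauss (i.s + t) (x - i.y)

/-- The heat flow of a wave packet, as a function on the plane. -/
def profile (a : ℝ) (i : WavePacket) (t : ℝ) (x : ℝ × ℝ) : ℝ :=
  longitudinal a i t x.1 * mode a i.n x.2

/-- The time derivative of `profile`. -/
def profileDeriv (a : ℝ) (i : WavePacket) (t : ℝ) (x : ℝ × ℝ) : ℝ :=
  Real.exp ((E1 a - freq a i.n ^ 2) * t) * ((E1 a - freq a i.n ^ 2) * gauss (i.s + t) (x.1 - i.y)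
    + gaussDeriv2 (i.s + t) (x.1 - i.y)) * mode a i.n x.2

/-- The heat flow of a wave packet, as a curve in `L²(Ω)`. -/
def curve (a : ℝ) (i : WavePacket) (t : ℝ) : L2 a := toL2 a (profile a i t)

/-- The velocity of `curve`. -/
def curveDeriv (a : ℝ) (i : WavePacket) (t : ℝ) : L2 a := toL2 a (profileDeriv a i t)

variable {a : ℝ} (i : WavePacket) {t : ℝ}

theorem memLp_longitudinal (ht : 0 < i.s + t) : MemLp (longitudinal a i t) 2 volume :=
  (memLp_gauss ht i.y).const_mul _

theorem memLp_profile (ht : 0 < i.s + t) : MemLp (profile a i t) 2 (stripMeasure a) :=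
  memLp_tensor (i.memLp_longitudinal ht) (contDiff_mode a i.n).continuous

theorem memLp_profileDeriv (ht : 0 < i.s + t) : MemLp (profileDeriv a i t) 2 (stripMeasure a) :=
  memLp_tensor ((((memLp_gauss ht i.y).const_mul _).add (memLp_gaussDeriv2 ht i.y)).const_mul _)
    (contDiff_mode a i.n).continuous

theorem curve_ae_eq (ht : 0 < i.s + t) : curve a i t =ᵐ[stripMeasure a] profile a i t :=
  toL2_ae_eq (i.memLp_profile ht)

theorem curveDeriv_ae_eq (ht : 0 < i.s + t) :
    curveDeriv a i t =ᵐ[stripMeasure a] profileDeriv a i t :=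
  toL2_ae_eq (i.memLp_profileDeriv ht)

theorem curve_mem (ha : 0 < a) (ht : 0 < i.s + t) :
    (curve a i t, curveDeriv a i t) ∈ shiftedLaplacian a := by
  let r := Real.exp ((E1 a - freq a i.n ^ 2) * t)
  have hm2 : MemLp (fun x => r * gaussDeriv2 (i.s + t) (x - i.y)) 2 volume :=
    (memLp_gaussDeriv2 ht i.y).const_mul r
  have h := mem_formOperator_tensor ha (g := longitudinal a i t) (h := mode a i.n)
    (contDiff_const.mul ((contDiff_gauss _).comp (contDiff_id.sub contDiff_const)))
    (contDiff_mode a i.n)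
    (fun x => ((hasDerivAt_gauss ht (x - i.y)).comp_sub_const x i.y).const_mul r)
    (fun x => ((hasDerivAt_gaussDeriv ht (x - i.y)).comp_sub_const x i.y).const_mul r)
    (hasDerivAt_mode a i.n) (hasDerivAt_modeDeriv a i.n)
    (i.memLp_longitudinal ht) ((memLp_gaussDeriv ht i.y).const_mul r)
    hm2 (mode_neg_self a i.n) (modeDeriv_self ha i.n)
  have m3 : MemLp (fun x : ℝ × ℝ => -(r * gaussDeriv2 (i.s + t) (x.1 - i.y) * mode a i.n x.2
      + longitudinal a i t x.1 * (-freq a i.n ^ 2 * mode a i.n x.2))) 2 (stripMeasure a) :=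
    ((memLp_tensor hm2 (contDiff_mode a i.n).continuous).add
      (memLp_tensor (i.memLp_longitudinal ht)
        (continuous_const.mul (contDiff_mode a i.n).continuous))).neg
  rw [mem_shiftedLaplacian]
  refine (congrArg (fun f => (curve a i t, f) ∈ formOperator (formDomain a)) (Lp.ext ?_)).mpr h
  filter_upwards [Lp.coeFn_sub (E1 a • curve a i t) (curveDeriv a i t),
    Lp.coeFn_smul (E1 a) (curve a i t), i.curve_ae_eq ht, i.curveDeriv_ae_eq ht,
    toL2_ae_eq m3] with x h1 h2 h3 h4 h5
  rw [h1, h5, Pi.sub_apply, h2, Pi.smul_apply, h3, h4]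
  simp only [profile, profileDeriv, longitudinal, smul_eq_mul, r]
  ring

theorem hasDerivAt_profile (ht : 0 < i.s + t) (x : ℝ × ℝ) :
    HasDerivAt (fun t => profile a i t x) (profileDeriv a i t x) t := by
  have h1 : HasDerivAt (fun t => Real.exp ((E1 a - freq a i.n ^ 2) * t))
      (Real.exp ((E1 a - freq a i.n ^ 2) * t) * (E1 a - freq a i.n ^ 2)) t := by
    simpa using ((hasDerivAt_id t).const_mul (E1 a - freq a i.n ^ 2)).exp
  have h2 := (hasDerivAt_gauss_time ht (x.1 - i.y)).comp_const_add i.s t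
  refine ((h1.mul h2).mul_const (mode a i.n x.2)).congr_deriv ?_
  rw [profileDeriv]
  ring

theorem hasDerivAt_curve (ht : 0 < i.s + t) :
    HasDerivAt (curve a i) (curveDeriv a i t) t := by
  set σ := i.s + t with hσ
  set q := E1 a - freq a i.n ^ 2 with hq
  have hball : ∀ τ ∈ Metric.ball t (σ / 2), σ / 2 ≤ i.s + τ ∧ i.s + τ ≤ 3 / 2 * σ := by
    intro τ hτ
    rw [Metric.mem_ball, Real.dist_eq, abs_lt] at hτ
    constructor <;> linarith [hτ.1, hτ.2]
  have hpos : ∀ τ ∈ Metric.ball t (σ / 2), 0 < i.s + τ := fun τ hτ =>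
    (half_pos ht).trans_le (hball τ hτ).1
  have hB : MemLp (fun x : ℝ × ℝ => Real.exp (|q| * (|t| + σ / 2)) *
      ((|q| + 6 / σ) * ((√(σ / 2))⁻¹ * Real.exp (-(x.1 - i.y) ^ 2 / (12 * σ)))) * 1)
      2 (stripMeasure a) :=
    memLp_tensor (h := fun _ => 1) ((((memLp_exp_neg_sq (by positivity) i.y).const_mul _).const_mul
      _).const_mul _) continuous_const
  refine hasDerivAt_of_dominated (half_pos ht) hB (fun τ hτ => i.curve_ae_eq (hpos τ hτ))
    (i.curveDeriv_ae_eq ht) (fun x τ hτ => i.hasDerivAt_profile (hpos τ hτ) x) ?_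
  intro x τ hτ
  have hp := hpos τ hτ
  obtain ⟨h1, h2⟩ := hball τ hτ
  set z := x.1 - i.y
  have e1 : Real.exp (q * τ) ≤ Real.exp (|q| * (|t| + σ / 2)) := by
    rw [Real.exp_le_exp]
    refine (le_abs_self _).trans ?_
    rw [abs_mul]
    gcongr
    rw [Metric.mem_ball, Real.dist_eq] at hτ
    have := abs_sub_abs_le_abs_sub τ t
    linarith
  have e2 : (√(i.s + τ))⁻¹ ≤ (√(σ / 2))⁻¹ := by gcongr
  have e3 : Real.exp (-z ^ 2 / (8 * (i.s + τ))) ≤ Real.exp (-z ^ 2 / (12 * σ)) := by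
    rw [Real.exp_le_exp, neg_div, neg_div, neg_le_neg_iff]
    exact div_le_div_of_nonneg_left (sq_nonneg z) (by positivity) (by linarith)
  have e4 : |gauss (i.s + τ) z| ≤ (√(σ / 2))⁻¹ * Real.exp (-z ^ 2 / (12 * σ)) := by
    rw [abs_of_nonneg (gauss_nonneg _ _), gauss]
    exact mul_le_mul e2 ((exp_le_exp_wider hp z).trans e3) (Real.exp_pos _).le (by positivity)
  have e5 : |gaussDeriv2 (i.s + τ) z|
      ≤ 6 / σ * ((√(σ / 2))⁻¹ * Real.exp (-z ^ 2 / (12 * σ))) := by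
    refine (abs_gaussDeriv2_le hp z).trans ?_
    rw [mul_assoc]
    gcongr ?_ * (?_ * ?_)
    rw [div_le_div_iff₀ hp ht]
    linarith
  rw [profileDeriv, abs_mul, abs_mul, abs_of_pos (Real.exp_pos _)]
  gcongr
  · refine (abs_add_le _ _).trans ?_
    rw [abs_mul, add_mul]
    gcongr
  · exact abs_mode_le a i.n x.2

theorem curve_shift (ht : 0 ≤ t) {τ : ℝ} (hτ : 0 ≤ τ) :
    curve a i (τ + t) = Real.exp ((E1 a - freq a i.n ^ 2) * t) •
      curve a ⟨i.n, i.s + t, add_pos_of_pos_of_nonneg i.s_pos ht, i.y⟩ τ := by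
  have hs := i.s_pos
  let j : WavePacket := ⟨i.n, i.s + t, add_pos_of_pos_of_nonneg i.s_pos ht, i.y⟩
  refine Lp.ext ?_
  filter_upwards [Lp.coeFn_smul (Real.exp ((E1 a - freq a i.n ^ 2) * t)) (curve a j τ),
    i.curve_ae_eq (a := a) (t := τ + t) (by positivity),
    j.curve_ae_eq (a := a) (t := τ) (add_pos_of_pos_of_nonneg j.s_pos hτ)] with x h1 h2 h3
  rw [h1, h2, Pi.smul_apply, h3]
  simp only [profile, longitudinal, smul_eq_mul, j]
  rw [mul_add, Real.exp_add, show i.s + (τ + t) = i.s + t + τ by ring]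
  ring

end WavePacket

/-! ### Uniqueness of moments -/

section MomentGeneratingFunction

variable {α : Type*} [MeasurableSpace α] {μ : Measure α}

/-- The integral of a signed density, as a difference of masses of its positive and negative part. -/
theorem setIntegral_eq_withDensity_sub {p : α → ℝ} (hp : Integrable p μ) {S : Set α}
    (hS : MeasurableSet S) : ∫ x in S, p x ∂μ
      = (μ.withDensity (fun x => ENNReal.ofReal (p x)) S).toReal
        - (μ.withDensity (fun x => ENNReal.ofReal (-p x)) S).toReal := by
  rw [integral_eq_lintegral_pos_part_sub_lintegral_neg_part hp.integrableOn,
    withDensity_apply _ hS, withDensity_apply _ hS]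

/-- A signed density whose two-sided Laplace transform along `X` vanishes has vanishing integrals
over the sets `{X ∈ B}`: the positive and negative parts have the same moment generating function,
hence induce the same law of `X`. -/
theorem setIntegral_preimage_eq_zero_of_integral_mul_exp {p X : α → ℝ} (hp : Integrable p μ)
    (hX : Measurable X) (hint : ∀ ζ : ℝ, Integrable (fun x => p x * Real.exp (ζ * X x)) μ)
    (h0 : ∀ ζ : ℝ, ∫ x, p x * Real.exp (ζ * X x) ∂μ = 0) {B : Set ℝ} (hB : MeasurableSet B) :
    ∫ x in X ⁻¹' B, p x ∂μ = 0 := by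
  let μ₁ := μ.withDensity fun x => ENNReal.ofReal (p x)
  let μ₂ := μ.withDensity fun x => ENNReal.ofReal (-p x)
  have : IsFiniteMeasure μ₁ := isFiniteMeasure_withDensity_ofReal hp.2
  have : IsFiniteMeasure μ₂ := isFiniteMeasure_withDensity_ofReal hp.neg.2
  have hm₁ : AEMeasurable (fun x => ENNReal.ofReal (p x)) μ := hp.aemeasurable.ennreal_ofReal
  have hm₂ : AEMeasurable (fun x => ENNReal.ofReal (-p x)) μ := hp.neg.aemeasurable.ennreal_ofReal
  have hi₁ : ∀ ζ, Integrable (fun x => (ENNReal.ofReal (p x)).toReal • Real.exp (ζ * X x)) μ := by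
    intro ζ
    refine (hint ζ).mono (hm₁.ennreal_toReal.aestronglyMeasurable.smul (by fun_prop))
      (Eventually.of_forall fun x => ?_)
    simp only [ENNReal.toReal_ofReal', smul_eq_mul, norm_mul, Real.norm_eq_abs]
    refine mul_le_mul_of_nonneg_right ?_ (abs_nonneg _)
    rw [abs_of_nonneg (le_max_right _ (0 : ℝ))]
    exact max_le (le_abs_self _) (abs_nonneg _)
  have hi₂ : ∀ ζ, Integrable (fun x => (ENNReal.ofReal (-p x)).toReal • Real.exp (ζ * X x)) μ := by
    intro ζ
    refine (hint ζ).mono (hm₂.ennreal_toReal.aestronglyMeasurable.smul (by fun_prop))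
      (Eventually.of_forall fun x => ?_)
    simp only [ENNReal.toReal_ofReal', smul_eq_mul, norm_mul, Real.norm_eq_abs]
    refine mul_le_mul_of_nonneg_right ?_ (abs_nonneg _)
    rw [abs_of_nonneg (le_max_right _ (0 : ℝ))]
    exact max_le (neg_le_abs _) (abs_nonneg _)
  have hI₁ : ∀ ζ, Integrable (fun x => Real.exp (ζ * X x)) μ₁ := fun ζ =>
    (integrable_withDensity_iff_integrable_smul₀' hm₁ (by simp)).2 (hi₁ ζ)
  have hI₂ : ∀ ζ, Integrable (fun x => Real.exp (ζ * X x)) μ₂ := fun ζ =>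
    (integrable_withDensity_iff_integrable_smul₀' hm₂ (by simp)).2 (hi₂ ζ)
  have hmgf : ProbabilityTheory.mgf X μ₁ = ProbabilityTheory.mgf X μ₂ := by
    funext ζ
    rw [ProbabilityTheory.mgf, ProbabilityTheory.mgf,
      integral_withDensity_eq_integral_toReal_smul₀ hm₁ (by simp),
      integral_withDensity_eq_integral_toReal_smul₀ hm₂ (by simp), ← sub_eq_zero,
      ← integral_sub (hi₁ ζ) (hi₂ ζ), ← h0 ζ]
    refine integral_congr_ae (Eventually.of_forall fun x => ?_)
    simp only [ENNReal.toReal_ofReal', smul_eq_mul, ← sub_mul, max_zero_sub_max_neg_zero_eq_self]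
  have hmass : μ₁ univ = μ₂ univ := by
    have := congrFun hmgf 0
    simp only [ProbabilityTheory.mgf_zero', measureReal_def] at this
    exact (ENNReal.toReal_eq_toReal_iff' (measure_ne_top _ _) (measure_ne_top _ _)).1 this
  have hset : ∀ z : ℂ, z.re ∈ interior (ProbabilityTheory.integrableExpSet X μ₁) := by
    intro z
    have : ProbabilityTheory.integrableExpSet X μ₁ = univ := eq_univ_of_forall fun ζ => hI₁ ζ
    simp [this]
  have hlaw : μ₁.map X = μ₂.map X := by
    refine Measure.ext_of_complexMGF_eq hX.aemeasurable hX.aemeasurable (funext fun z => ?_)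
    refine ProbabilityTheory.eqOn_complexMGF_of_mgf' hmgf ?_ (hset z)
    rw [← Measure.measure_univ_eq_zero, hmass, Measure.measure_univ_eq_zero]
  rw [setIntegral_eq_withDensity_sub hp (hX hB), sub_eq_zero]
  change (μ₁ (X ⁻¹' B)).toReal = (μ₂ (X ⁻¹' B)).toReal
  rw [← Measure.map_apply hX hB, ← Measure.map_apply hX hB, hlaw]

/-- Expansion of the exponential under the integral. -/
theorem integral_mul_exp_eq_zero_of_moments {p X : α → ℝ} (hp : Integrable p μ)
    (hX : Measurable X) (hX1 : ∀ x, |X x| ≤ 1) (h0 : ∀ k : ℕ, ∫ x, p x * X x ^ k ∂μ = 0) (ζ : ℝ) :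
    ∫ x, p x * Real.exp (ζ * X x) ∂μ = 0 := by
  have hint : ∀ k : ℕ, Integrable (fun x => p x * X x ^ k) μ := fun k =>
    hp.mul_bdd (c := 1) (by fun_prop) (Eventually.of_forall fun x => by
      rw [norm_pow]; exact pow_le_one₀ (norm_nonneg _) (hX1 x))
  have hF : ∀ k : ℕ, Integrable (fun x => ζ ^ k / k.factorial * (p x * X x ^ k)) μ := fun k =>
    (hint k).const_mul _
  have hsum := hasSum_integral_of_summable_integral_norm hF ?_
  · have h1 : ∀ x, ∑' k : ℕ, ζ ^ k / k.factorial * (p x * X x ^ k)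
        = p x * Real.exp (ζ * X x) := by
      intro x
      rw [Real.exp_eq_exp_ℝ, NormedSpace.exp_eq_tsum_div, ← tsum_mul_left]
      congr 1
      funext k
      rw [mul_pow]
      ring
    simp only [h1, integral_const_mul, h0, mul_zero] at hsum
    exact hsum.unique hasSum_zero
  · refine Summable.of_nonneg_of_le (fun k => integral_nonneg fun x => norm_nonneg _) (fun k => ?_)
      ((Real.summable_pow_div_factorial |ζ|).mul_right (∫ x, |p x| ∂μ))
    rw [← integral_const_mul]
    refine integral_mono (hF k).norm (hp.abs.const_mul _) fun x => ?_
    simp only [norm_mul, norm_div, norm_pow, Real.norm_eq_abs, Nat.abs_cast]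
    gcongr
    exact mul_le_of_le_one_right (abs_nonneg _) (pow_le_one₀ (abs_nonneg _) (hX1 x))

end MomentGeneratingFunction

/-- An integrable function with vanishing integrals over measurable rectangles vanishes. -/
theorem ae_eq_zero_of_setIntegral_prod_eq_zero {μ : Measure (ℝ × ℝ)} {h : ℝ × ℝ → ℝ}
    (hh : Integrable h μ) (h0 : ∀ B C : Set ℝ, MeasurableSet B → MeasurableSet C →
      ∫ x in B ×ˢ C, h x ∂μ = 0) : h =ᵐ[μ] 0 := by
  let μ₁ := μ.withDensity fun x => ENNReal.ofReal (h x)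
  let μ₂ := μ.withDensity fun x => ENNReal.ofReal (-h x)
  have : IsFiniteMeasure μ₁ := isFiniteMeasure_withDensity_ofReal hh.2
  have : IsFiniteMeasure μ₂ := isFiniteMeasure_withDensity_ofReal hh.neg.2
  have hμ : μ₁ = μ₂ := by
    refine Measure.ext_prod fun {B C} hB hC => ?_
    have := h0 B C hB hC
    rw [setIntegral_eq_withDensity_sub hh (hB.prod hC), sub_eq_zero] at this
    exact (ENNReal.toReal_eq_toReal_iff' (measure_ne_top _ _) (measure_ne_top _ _)).1 this
  refine hh.ae_eq_zero_of_forall_setIntegral_eq_zero fun S hS _ => ?_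
  rw [setIntegral_eq_withDensity_sub hh hS, sub_eq_zero]
  change (μ₁ S).toReal = (μ₂ S).toReal
  rw [hμ]

/-! ### Density of wave packets -/

/-- The function `cos 2θ` of the transversal variable, where `mode a 0 = sin θ`. -/
def cosDouble (a b : ℝ) : ℝ := Real.cos (2 * (freq a 0 * (b + a)))

theorem abs_cosDouble_le (a b : ℝ) : |cosDouble a b| ≤ 1 := Real.abs_cos_le_one _

theorem mode_zero_mul_cosDouble (a b : ℝ) :
    mode a 0 b * cosDouble a b = (mode a 1 b - mode a 0 b) / 2 := by
  have h : freq a 1 * (b + a) = freq a 0 * (b + a) + 2 * (freq a 0 * (b + a)) := by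
    simp only [freq]; push_cast; ring
  rw [mode, mode, cosDouble, h]
  generalize freq a 0 * (b + a) = θ
  have h' := Real.sin_sub (2 * θ) θ
  rw [show 2 * θ - θ = θ by ring] at h'
  rw [Real.sin_add]
  linarith

theorem mode_succ_mul_cosDouble (a : ℝ) (n : ℕ) (b : ℝ) :
    mode a (n + 1) b * cosDouble a b = (mode a (n + 2) b + mode a n b) / 2 := by
  have h1 : freq a (n + 2) * (b + a) = freq a (n + 1) * (b + a) + 2 * (freq a 0 * (b + a)) := by
    simp only [freq]; push_cast; ring
  have h2 : freq a n * (b + a) = freq a (n + 1) * (b + a) - 2 * (freq a 0 * (b + a)) := by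
    simp only [freq]; push_cast; ring
  rw [mode, mode, mode, cosDouble, h1, h2, Real.sin_add, Real.sin_sub]
  ring

theorem freq_zero_mul_mem {a : ℝ} (ha : 0 < a) {b : ℝ} (hb : b ∈ Ioo (-a) a) :
    freq a 0 * (b + a) ∈ Ioo 0 (Real.pi / 2) := by
  have h : freq a 0 * (b + a) = Real.pi / 2 * ((b + a) / (2 * a)) := by
    rw [freq]; field_simp; push_cast; ring
  have h1 : 0 < (b + a) / (2 * a) := div_pos (by linarith [hb.1]) (by positivity)
  have h2 : (b + a) / (2 * a) < 1 := by rw [div_lt_one (by positivity)]; linarith [hb.2]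
  rw [h]
  exact ⟨by positivity, mul_lt_of_lt_one_right (by positivity) h2⟩

theorem mode_zero_pos {a : ℝ} (ha : 0 < a) {b : ℝ} (hb : b ∈ Ioo (-a) a) : 0 < mode a 0 b := by
  obtain ⟨h1, h2⟩ := freq_zero_mul_mem ha hb
  exact Real.sin_pos_of_pos_of_lt_pi h1 (by linarith)

/-- `cosDouble` is injective on the cross-section, with an explicit left inverse. -/
theorem arccos_cosDouble {a : ℝ} (ha : 0 < a) {b : ℝ} (hb : b ∈ Ioo (-a) a) :
    Real.arccos (cosDouble a b) / (2 * freq a 0) - a = b := by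
  obtain ⟨h1, h2⟩ := freq_zero_mul_mem ha hb
  have h3 : freq a 0 ≠ 0 := left_ne_zero_of_mul h1.ne'
  rw [cosDouble, Real.arccos_cos (by linarith) (by linarith)]
  field_simp
  ring

/-- A function on the strip is determined by its exponential moments in `x₁` and its polynomial
moments in `cos 2θ(x₂)`. -/
theorem ae_eq_zero_of_moments {a : ℝ} (ha : 0 < a) {h : ℝ × ℝ → ℝ}
    (hint : ∀ ζ : ℝ, Integrable (fun x => h x * Real.exp (ζ * x.1)) (stripMeasure a))
    (h0 : ∀ (ζ : ℝ) (k : ℕ),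
      ∫ x, h x * cosDouble a x.2 ^ k * Real.exp (ζ * x.1) ∂stripMeasure a = 0) :
    h =ᵐ[stripMeasure a] 0 := by
  have hh : Integrable h (stripMeasure a) := by simpa using hint 0
  have hcm : Measurable fun x : ℝ × ℝ => cosDouble a x.2 := by unfold cosDouble; fun_prop
  have hbdd : ∀ (k : ℕ) {f : ℝ × ℝ → ℝ}, Integrable f (stripMeasure a) →
      Integrable (fun x => f x * cosDouble a x.2 ^ k) (stripMeasure a) := fun k f hf =>
    hf.mul_bdd (c := 1) (hcm.pow_const k).aestronglyMeasurable (Eventually.of_forall fun x => by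
      rw [norm_pow]; exact pow_le_one₀ (norm_nonneg _) (abs_cosDouble_le a x.2))
  have h1 : ∀ B : Set ℝ, MeasurableSet B → ∀ k : ℕ,
      ∫ x in Prod.fst ⁻¹' B, h x * cosDouble a x.2 ^ k ∂stripMeasure a = 0 := fun B hB k =>
    setIntegral_preimage_eq_zero_of_integral_mul_exp (hbdd k hh) measurable_fst
      (fun ζ => (hbdd k (hint ζ)).congr (Eventually.of_forall fun x => by simp only; ring))
      (fun ζ => h0 ζ k) hB
  refine ae_eq_zero_of_setIntegral_prod_eq_zero hh fun B C hB hC => ?_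
  -- `L` recovers `x₂` from `cos 2θ(x₂)`, so that `{x₂ ∈ C}` is of the form `{cos 2θ(x₂) ∈ L⁻¹ C}`.
  let L : ℝ → ℝ := fun z => Real.arccos z / (2 * freq a 0) - a
  have hL : Measurable L := by fun_prop
  have h2 := setIntegral_preimage_eq_zero_of_integral_mul_exp
    (μ := (stripMeasure a).restrict (Prod.fst ⁻¹' B)) (p := h) (X := fun x => cosDouble a x.2)
    hh.restrict hcm (fun ζ => ?_)
    (integral_mul_exp_eq_zero_of_moments hh.restrict hcm (fun x => abs_cosDouble_le a x.2)
      (h1 B hB)) (hL hC)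
  · rw [Measure.restrict_restrict (hcm (hL hC))] at h2
    rw [← h2]
    refine setIntegral_congr_set ?_
    filter_upwards [ae_mem_strip a] with x hx
    have := arccos_cosDouble ha hx.2
    apply propext
    change (x.1 ∈ B ∧ x.2 ∈ C) ↔ (L (cosDouble a x.2) ∈ C ∧ x.1 ∈ B)
    rw [show L (cosDouble a x.2) = x.2 from this, and_comm]
  · refine hh.restrict.mul_bdd (c := Real.exp |ζ|)
      (hcm.const_mul ζ).exp.aestronglyMeasurable (Eventually.of_forall fun x => ?_)
    rw [Real.norm_eq_abs, Real.abs_exp, Real.exp_le_exp]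
    refine (le_abs_self _).trans ?_
    rw [abs_mul]
    exact mul_le_of_le_one_right (abs_nonneg _) (abs_cosDouble_le a x.2)

/-- An `L²` function orthogonal to all wave packets vanishes. -/
theorem eq_zero_of_inner_curve_eq_zero {a : ℝ} (ha : 0 < a) {f : L2 a}
    (hf : ∀ i : WavePacket, inner ℝ (WavePacket.curve a i 0) f = 0) : f = 0 := by
  have hint : ∀ (ζ : ℝ) {ψ : ℝ → ℝ}, Continuous ψ →
      Integrable (fun x => f x * (Real.exp (-x.1 ^ 2 + ζ * x.1) * ψ x.2)) (stripMeasure a) := by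
    intro ζ ψ hψ
    have hg : MemLp (fun s : ℝ => Real.exp (-s ^ 2 + ζ * s)) 2 volume := by
      refine ((memLp_exp_neg_sq one_pos (ζ / 2)).const_mul (Real.exp (ζ ^ 2 / 4))).congr_norm
        (by fun_prop) (Eventually.of_forall fun s => ?_)
      rw [← Real.exp_add]
      congr 2
      ring
    exact (Lp.memLp f).integrable_mul (memLp_tensor hg hψ)
  have hmc : ∀ n, Continuous (mode a n) := fun n => (contDiff_mode a n).continuous
  have hcc : Continuous (cosDouble a) := by unfold cosDouble; fun_prop
  have h0 : ∀ (ζ : ℝ) (k n : ℕ), ∫ x, f x * (Real.exp (-x.1 ^ 2 + ζ * x.1)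
      * (mode a n x.2 * cosDouble a x.2 ^ k)) ∂stripMeasure a = 0 := by
    intro ζ k
    induction k with
    | zero =>
      intro n
      -- A packet of width `1 / 4` is a multiple of `exp (-x₁² + ζ x₁)` times the mode.
      let i : WavePacket := ⟨n, 1 / 4, by norm_num, ζ / 2⟩
      have h := hf i
      rw [inner_eq_integral (i.curve_ae_eq (by simp [i])) (EventuallyEq.refl _ _)] at h
      have h2 : √(1 / 4 : ℝ) = 1 / 2 := by
        rw [show (1 / 4 : ℝ) = (1 / 2) ^ 2 by norm_num, Real.sqrt_sq (by norm_num)]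
      have h3 : ∀ x : ℝ × ℝ, WavePacket.profile a i 0 x * f x = 2 * Real.exp (-(ζ ^ 2 / 4)) *
          (f x * (Real.exp (-x.1 ^ 2 + ζ * x.1) * (mode a n x.2 * cosDouble a x.2 ^ 0))) := by
        intro x
        have h4 : Real.exp (-(x.1 - ζ / 2) ^ 2)
            = Real.exp (-(ζ ^ 2 / 4)) * Real.exp (-x.1 ^ 2 + ζ * x.1) := by
          rw [← Real.exp_add]
          congr 1
          ring
        simp only [WavePacket.profile, WavePacket.longitudinal, gauss, i, mul_zero, Real.exp_zero,
          add_zero, h2, pow_zero]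
        norm_num
        rw [h4]
        ring
      simp only [h3, integral_const_mul] at h
      exact (mul_eq_zero.1 h).resolve_left (by positivity)
    | succ k ih =>
      intro n
      have hi := fun n => hint ζ (ψ := fun b => mode a n b * cosDouble a b ^ k)
        ((hmc n).mul (hcc.pow k))
      cases n with
      | zero =>
        have : ∀ x : ℝ × ℝ, f x * (Real.exp (-x.1 ^ 2 + ζ * x.1)
            * (mode a 0 x.2 * cosDouble a x.2 ^ (k + 1)))
            = 1 / 2 * (f x * (Real.exp (-x.1 ^ 2 + ζ * x.1) * (mode a 1 x.2 * cosDouble a x.2 ^ k))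
              - f x * (Real.exp (-x.1 ^ 2 + ζ * x.1)
                * (mode a 0 x.2 * cosDouble a x.2 ^ k))) := by
          intro x
          rw [pow_succ' (cosDouble a x.2), ← mul_assoc (mode a 0 x.2), mode_zero_mul_cosDouble]
          ring
        simp only [this, integral_const_mul]
        rw [integral_sub (hi 1) (hi 0), ih, ih]
        simp
      | succ n =>
        have : ∀ x : ℝ × ℝ, f x * (Real.exp (-x.1 ^ 2 + ζ * x.1)
            * (mode a (n + 1) x.2 * cosDouble a x.2 ^ (k + 1)))
            = 1 / 2 * (f x * (Real.exp (-x.1 ^ 2 + ζ * x.1)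
                * (mode a (n + 2) x.2 * cosDouble a x.2 ^ k))
              + f x * (Real.exp (-x.1 ^ 2 + ζ * x.1)
                * (mode a n x.2 * cosDouble a x.2 ^ k))) := by
          intro x
          rw [pow_succ' (cosDouble a x.2), ← mul_assoc (mode a (n + 1) x.2), mode_succ_mul_cosDouble]
          ring
        simp only [this, integral_const_mul]
        rw [integral_add (hi (n + 2)) (hi n), ih, ih]
        simp
  have hexp : ∀ (ζ : ℝ) (x : ℝ × ℝ), f x * (Real.exp (-x.1 ^ 2) * mode a 0 x.2)
      * Real.exp (ζ * x.1) = f x * (Real.exp (-x.1 ^ 2 + ζ * x.1) * mode a 0 x.2) := by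
    intro ζ x
    rw [Real.exp_add]
    ring
  -- The factor `mode a 0 = sin θ` is positive on the strip, so it can be divided out at the end.
  have key := ae_eq_zero_of_moments ha
    (h := fun x => f x * (Real.exp (-x.1 ^ 2) * mode a 0 x.2))
    (fun ζ => by simpa only [hexp] using hint ζ (hmc 0)) fun ζ k => by
      rw [← h0 ζ k 0]
      refine integral_congr_ae (Eventually.of_forall fun x => ?_)
      simp only
      rw [mul_right_comm, hexp]
      ring
  refine Lp.ext ?_
  filter_upwards [key, ae_mem_strip a, Lp.coeFn_zero ℝ 2 (stripMeasure a)] with x hx hs h0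
  rw [h0]
  have hpos := mode_zero_pos ha hs.2
  exact (mul_eq_zero.1 hx).resolve_right (by positivity)

/-! ### Generation of the heat semigroup -/

/-- The flows of wave packets satisfy the hypotheses of the generation theorem. -/
theorem isSolutionFamily_curve {a : ℝ} (ha : 0 < a) :
    IsSolutionFamily (shiftedLaplacian a : Set (L2 a × L2 a)) (WavePacket.curve a)
      (WavePacket.curveDeriv a) where
  hasDerivAt i t ht := i.hasDerivAt_curve (add_pos_of_pos_of_nonneg i.s_pos ht)
  mem i t ht := i.curve_mem ha (add_pos_of_pos_of_nonneg i.s_pos ht)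
  shift i t ht := ⟨_, _, fun s hs => i.curve_shift ht hs⟩
  dense := by
    rw [Submodule.dense_iff_topologicalClosure_eq_top, Submodule.topologicalClosure_eq_top_iff,
      Submodule.eq_bot_iff]
    intro f hf
    refine eq_zero_of_inner_curve_eq_zero ha fun i => ?_
    exact (Submodule.mem_orthogonal _ _).1 hf _ (Submodule.subset_span ⟨i, rfl⟩)

theorem isSemigroupGeneratedBy_S0 {a : ℝ} (ha : 0 < a) :
    IsSemigroupGeneratedBy (shiftedLaplacianGraph a) (S0 a) := by
  have h : ∃ T : ℝ → L2 a →L[ℝ] L2 a, IsSemigroupGeneratedBy (shiftedLaplacianGraph a) T := by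
    rw [← coe_shiftedLaplacian]
    exact exists_isSemigroupGeneratedBy (shiftedLaplacian a) (isClosed_shiftedLaplacian a)
      (isSymmetricGraph_shiftedLaplacian a) inner_le_of_mem_shiftedLaplacian
      (isSolutionFamily_curve ha)
  rw [S0, expSemigroup, dif_pos h]
  exact h.choose_spec

theorem S0_curve {a : ℝ} (ha : 0 < a) (i : WavePacket) {t : ℝ} (ht : 0 ≤ t) :
    S0 a t (WavePacket.curve a i 0) = WavePacket.curve a i t :=
  (coe_shiftedLaplacian a ▸ isSemigroupGeneratedBy_S0 ha).apply_eq
    (isSymmetricGraph_shiftedLaplacian a) (isSolutionFamily_curve ha) i ht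

theorem inner_S0_curve {a : ℝ} (ha : 0 < a) (u : L2 a) (i : WavePacket) {t : ℝ} (ht : 0 ≤ t) :
    inner ℝ (S0 a t u) (WavePacket.curve a i 0) = inner ℝ u (WavePacket.curve a i t) :=
  (coe_shiftedLaplacian a ▸ isSemigroupGeneratedBy_S0 ha).inner_apply
    (isSymmetricGraph_shiftedLaplacian a) (isSolutionFamily_curve ha) u i ht

/-! ### Integrals of Gaussians and modes -/

theorem sq_integral_mul_le {α : Type*} [MeasurableSpace α] {μ : Measure α} {f g : α → ℝ}
    (hf : MemLp f 2 μ) (hg : MemLp g 2 μ) :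
    (∫ x, f x * g x ∂μ) ^ 2 ≤ (∫ x, f x ^ 2 ∂μ) * ∫ x, g x ^ 2 ∂μ := by
  have h := real_inner_mul_inner_self_le hf.toLp hg.toLp
  rw [inner_eq_integral hf.coeFn_toLp hg.coeFn_toLp, inner_eq_integral hf.coeFn_toLp hf.coeFn_toLp,
    inner_eq_integral hg.coeFn_toLp hg.coeFn_toLp] at h
  simpa only [sq] using h

theorem norm_sq_eq_integral {α : Type*} [MeasurableSpace α] {μ : Measure α} {u : Lp ℝ 2 μ}
    {f : α → ℝ} (hu : u =ᵐ[μ] f) : ‖u‖ ^ 2 = ∫ x, f x ^ 2 ∂μ := by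
  rw [← real_inner_self_eq_norm_sq, inner_eq_integral hu hu]
  simp only [sq]

/-- The semigroup property of the one-dimensional heat kernel. -/
theorem integral_gauss_mul_gauss {s t : ℝ} (hs : 0 < s) (ht : 0 < t) (x y : ℝ) :
    ∫ z, gauss s (z - y) * gauss t (z - x) = 2 * √Real.pi * gauss (s + t) (x - y) := by
  -- Completing the square in the exponent.
  have h1 : ∀ z, gauss s (z - y) * gauss t (z - x)
      = (√s)⁻¹ * (√t)⁻¹ * Real.exp (-(x - y) ^ 2 / (4 * (s + t)))
        * Real.exp (-((s + t) / (4 * s * t)) * (z - (t * y + s * x) / (s + t)) ^ 2) := by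
    intro z
    rw [gauss, gauss, mul_assoc _ (Real.exp _) (Real.exp _), ← Real.exp_add, mul_mul_mul_comm,
      ← Real.exp_add]
    congr 2
    field_simp
    ring
  simp only [h1, integral_const_mul]
  rw [integral_sub_right_eq_self (fun z => Real.exp (-((s + t) / (4 * s * t)) * z ^ 2)),
    integral_gaussian, gauss]
  have h2 : Real.pi / ((s + t) / (4 * s * t)) = (2 : ℝ) ^ 2 * Real.pi * s * t / (s + t) := by
    field_simp
    norm_num
  have hs' := (Real.sqrt_pos.2 hs).ne'
  have ht' := (Real.sqrt_pos.2 ht).ne'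
  rw [h2, Real.sqrt_div (by positivity), Real.sqrt_mul (by positivity), Real.sqrt_mul (by positivity),
    Real.sqrt_mul (by positivity), Real.sqrt_sq (by norm_num)]
  field_simp

theorem integral_gauss_sq {s : ℝ} (hs : 0 < s) (y : ℝ) :
    ∫ z, gauss s (z - y) ^ 2 = √(2 * Real.pi) / √s := by
  simp only [sq]
  rw [integral_gauss_mul_gauss hs hs, gauss, sub_self]
  have h : √(s + s) = √2 * √s := by rw [← Real.sqrt_mul (by norm_num), two_mul]
  have h2 : √(2 * Real.pi) = √2 * √Real.pi := Real.sqrt_mul (by norm_num) _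
  have h3 : √2 * √2 = (2 : ℝ) := Real.mul_self_sqrt (by norm_num)
  have hs' := (Real.sqrt_pos.2 hs).ne'
  rw [h, h2]
  simp only [ne_eq, OfNat.ofNat_ne_zero, not_false_eq_true, zero_pow, neg_zero, zero_div,
    Real.exp_zero, mul_one]
  field_simp
  linarith

theorem integral_cos_eq_zero {a : ℝ} (ha : 0 < a) {j : ℤ} (hj : j ≠ 0) :
    ∫ b in Ioo (-a) a, Real.cos (j * (Real.pi / (2 * a)) * (b + a)) = 0 := by
  have hc : (j : ℝ) * (Real.pi / (2 * a)) ≠ 0 :=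
    mul_ne_zero (Int.cast_ne_zero.2 hj) (by positivity)
  rw [← integral_Ioc_eq_integral_Ioo, ← intervalIntegral.integral_of_le (by linarith)]
  simp only [mul_add]
  rw [intervalIntegral.integral_comp_mul_add _ hc, integral_cos]
  have h1 : (j : ℝ) * (Real.pi / (2 * a)) * a + j * (Real.pi / (2 * a)) * a = j * Real.pi := by
    field_simp
    ring
  have h2 : (j : ℝ) * (Real.pi / (2 * a)) * -a + j * (Real.pi / (2 * a)) * a = 0 := by ring
  rw [h1, h2, Real.sin_int_mul_pi]
  simp

theorem integral_mode_mul_mode {a : ℝ} (ha : 0 < a) (n m : ℕ) :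
    ∫ b in Ioo (-a) a, mode a n b * mode a m b = if n = m then a else 0 := by
  have h : ∀ b, mode a n b * mode a m b
      = 1 / 2 * (Real.cos (((n - m : ℤ) : ℝ) * (Real.pi / (2 * a)) * (b + a))
        - Real.cos (((n + m + 1 : ℤ) : ℝ) * (Real.pi / (2 * a)) * (b + a))) := by
    intro b
    have h1 : ((n - m : ℤ) : ℝ) * (Real.pi / (2 * a)) * (b + a)
        = freq a n * (b + a) - freq a m * (b + a) := by
      simp only [freq]; push_cast; field_simp; ring
    have h2 : ((n + m + 1 : ℤ) : ℝ) * (Real.pi / (2 * a)) * (b + a)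
        = freq a n * (b + a) + freq a m * (b + a) := by
      simp only [freq]; push_cast; field_simp; ring
    rw [mode, mode, h1, h2, Real.cos_sub, Real.cos_add]
    ring
  have hint : ∀ c : ℝ, IntegrableOn (fun b => Real.cos (c * (b + a))) (Ioo (-a) a) := fun c =>
    ((by fun_prop : Continuous fun b => Real.cos (c * (b + a))).continuousOn.integrableOn_compact
      isCompact_Icc).mono_set Ioo_subset_Icc_self
  simp only [h, integral_const_mul]
  rw [integral_sub (hint _) (hint _), integral_cos_eq_zero ha (j := n + m + 1) (by omega)]
  split_ifs with hnm
  · subst hnm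
    simp only [sub_self, Int.cast_zero, zero_mul, Real.cos_zero, sub_zero]
    simp [show (0 : ℝ) ≤ a + a by linarith]
    ring
  · rw [integral_cos_eq_zero ha (by omega)]
    simp

/-- Parseval's identity for the transversal modes, with a weight in the longitudinal variable. -/
theorem integral_sq_sum_modes {a : ℝ} (ha : 0 < a) (N : Finset ℕ) (w : ℝ → ℝ) (g : ℕ → ℝ → ℝ)
    (hint : ∀ n m, Integrable fun x => w x * (g n x * g m x)) :
    ∫ x, w x.1 * (∑ n ∈ N, g n x.1 * mode a n x.2) ^ 2 ∂stripMeasure a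
      = a * ∑ n ∈ N, ∫ x, w x * g n x ^ 2 := by
  have hmc : ∀ n, Continuous (mode a n) := fun n => (contDiff_mode a n).continuous
  have hint' : ∀ n m, Integrable (fun x : ℝ × ℝ => w x.1 * (g n x.1 * g m x.1)
      * (mode a n x.2 * mode a m x.2)) (stripMeasure a) := by
    intro n m
    rw [stripMeasure_eq_prod]
    exact (hint n m).mul_prod ((((hmc n).mul (hmc m)).continuousOn.integrableOn_compact
      isCompact_Icc).mono_set Ioo_subset_Icc_self)
  have h : ∀ x : ℝ × ℝ, w x.1 * (∑ n ∈ N, g n x.1 * mode a n x.2) ^ 2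
      = ∑ n ∈ N, ∑ m ∈ N, w x.1 * (g n x.1 * g m x.1) * (mode a n x.2 * mode a m x.2) := by
    intro x
    rw [sq, Finset.sum_mul_sum, Finset.mul_sum]
    refine Finset.sum_congr rfl fun n _ => ?_
    rw [Finset.mul_sum]
    refine Finset.sum_congr rfl fun m _ => ?_
    ring
  simp only [h]
  rw [integral_finsetSum _ fun n _ => integrable_finsetSum _ fun m _ => hint' n m, Finset.mul_sum]
  refine Finset.sum_congr rfl fun n hn => ?_
  rw [integral_finsetSum _ fun m _ => hint' n m]
  have h2 : ∀ m, ∫ x, w x.1 * (g n x.1 * g m x.1) * (mode a n x.2 * mode a m x.2) ∂stripMeasure a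
      = if n = m then a * ∫ x, w x * g n x ^ 2 else 0 := by
    intro m
    rw [integral_tensor a (fun x => w x * (g n x * g m x)) fun b => mode a n b * mode a m b,
      integral_mode_mul_mode ha]
    split_ifs with hnm
    · subst hnm
      simp only [sq]
      ring
    · simp
  simp only [h2, Finset.sum_ite_eq, hn, if_true]

theorem E1_eq (a : ℝ) : E1 a = freq a 0 ^ 2 := by simp [E1, freq]

theorem E1_le_freq_sq {a : ℝ} (ha : 0 < a) (n : ℕ) : E1 a ≤ freq a n ^ 2 := by
  rw [E1_eq, freq, freq]
  gcongr
  simp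

/-- In the first mode the factor `exp (E₁ t)` cancels the transversal decay, and the norm of the packet
decays only through its spreading in `x₁`. -/
theorem norm_sq_curve_ground {a : ℝ} (ha : 0 < a) (i : WavePacket) (hi : i.n = 0) {t : ℝ}
    (ht : 0 < i.s + t) :
    ‖WavePacket.curve a i t‖ ^ 2 = a * (√(2 * Real.pi) / √(i.s + t)) := by
  rw [norm_sq_eq_integral (i.curve_ae_eq ht)]
  have h : ∀ x : ℝ × ℝ, WavePacket.profile a i t x ^ 2
      = gauss (i.s + t) (x.1 - i.y) ^ 2 * (mode a 0 x.2 * mode a 0 x.2) := by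
    intro x
    simp only [WavePacket.profile, WavePacket.longitudinal, hi, E1_eq, sub_self, zero_mul,
      Real.exp_zero, one_mul]
    ring
  simp only [h]
  rw [integral_tensor a (fun x => gauss (i.s + t) (x - i.y) ^ 2) fun b => mode a 0 b * mode a 0 b,
    integral_gauss_sq ht, integral_mode_mul_mode ha, if_pos rfl, mul_comm]

/-! ### The weighted space -/

theorem weight_pos (x : ℝ × ℝ) : 0 < weight x := Real.exp_pos _

theorem continuous_weight : Continuous weight := by unfold weight; fun_prop

theorem integrable_weightedMeasure_iff {a : ℝ} {f : ℝ × ℝ → ℝ} :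
    Integrable f (weightedMeasure a) ↔ Integrable (fun x => weight x * f x) (stripMeasure a) := by
  rw [weightedMeasure, integrable_withDensity_iff_integrable_smul'
    (continuous_weight.measurable.ennreal_ofReal) (by simp)]
  simp only [ENNReal.toReal_ofReal (weight_pos _).le, smul_eq_mul]

theorem integral_weightedMeasure (a : ℝ) (f : ℝ × ℝ → ℝ) :
    ∫ x, f x ∂weightedMeasure a = ∫ x, weight x * f x ∂stripMeasure a := by
  rw [weightedMeasure, integral_withDensity_eq_integral_toReal_smul
    (continuous_weight.measurable.ennreal_ofReal) (by simp)]
  simp only [ENNReal.toReal_ofReal (weight_pos _).le, smul_eq_mul]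

theorem norm_sq_L2K {a : ℝ} (u : L2K a) :
    ‖u‖ ^ 2 = ∫ x, weight x * u x ^ 2 ∂stripMeasure a := by
  rw [norm_sq_eq_integral (EventuallyEq.refl _ _), integral_weightedMeasure]

/-- Pairing of `L²(Ω, K)` with `L²(Ω, K⁻¹)`. -/
theorem inner_inclusion_le {a : ℝ} (u : L2K a) {v : L2 a} {p : ℝ × ℝ → ℝ}
    (hv : v =ᵐ[stripMeasure a] p) (hp : Continuous p) :
    inner ℝ (inclusion a u) v ^ 2
      ≤ ‖u‖ ^ 2 * ∫ x, (weight x)⁻¹ * p x ^ 2 ∂stripMeasure a := by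
  have hw := continuous_weight
  have hsq : ∀ x, √(weight x) ^ 2 = weight x := fun x => Real.sq_sqrt (weight_pos x).le
  have hsqrt : Continuous fun x => √(weight x) := hw.sqrt
  have hum := (memLp_of_mem_L2K u).1
  have h1 : MemLp (fun x => √(weight x) * u x) 2 (stripMeasure a) := by
    have hm : AEStronglyMeasurable (fun x => √(weight x) * u x) (stripMeasure a) :=
      hsqrt.aestronglyMeasurable.mul hum
    rw [memLp_two_iff_integrable_sq hm]
    simp only [mul_pow, hsq]
    exact integrable_weightedMeasure_iff.1 (Lp.memLp u).integrable_sq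
  have hp2 : MemLp p 2 (stripMeasure a) := (memLp_congr_ae hv).1 (Lp.memLp v)
  have h2 : MemLp (fun x => (√(weight x))⁻¹ * p x) 2 (stripMeasure a) := by
    refine hp2.mono ((hsqrt.inv₀ fun x => (Real.sqrt_pos.2 (weight_pos x)).ne').mul
      hp).aestronglyMeasurable (Eventually.of_forall fun x => ?_)
    rw [norm_mul]
    refine mul_le_of_le_one_left (norm_nonneg _) ?_
    rw [norm_inv, Real.norm_of_nonneg (Real.sqrt_nonneg _)]
    exact inv_le_one_of_one_le₀ (Real.one_le_sqrt.2 (Real.one_le_exp (by positivity)))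
  have key := sq_integral_mul_le h1 h2
  simp only [mul_pow, inv_pow, hsq] at key
  rw [norm_sq_L2K, inner_eq_integral (inclusion_ae_eq u) hv]
  refine le_of_eq_of_le ?_ key
  congr 1
  refine integral_congr_ae (Eventually.of_forall fun x => ?_)
  have := (Real.sqrt_pos.2 (weight_pos x)).ne'
  field_simp

/-! ### The upper bound -/

/-- The constant `(4π)⁻¹ √(2π) ∫ exp (-x²/4) dx`. -/
def decayConst : ℝ := (4 * Real.pi)⁻¹ * √(2 * Real.pi) * ∫ x : ℝ, Real.exp (-(1 / 4) * x ^ 2)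

theorem decayConst_nonneg : 0 ≤ decayConst := by
  unfold decayConst
  have : 0 ≤ ∫ x : ℝ, Real.exp (-(1 / 4) * x ^ 2) := integral_nonneg fun x => (Real.exp_pos _).le
  positivity

/-- `L² → L^∞` smoothing of the longitudinal heat flow for sums of Gaussians in the same mode: the
value at a point is the inner product of the initial value with a heat kernel. -/
theorem sq_sum_longitudinal_le {a : ℝ} (ha : 0 < a) (F : Finset WavePacket) (c : WavePacket → ℝ)
    {n : ℕ} (hF : ∀ i ∈ F, i.n = n) {t : ℝ} (ht : 0 < t) (x : ℝ) :
    (∑ i ∈ F, c i * i.longitudinal a t x) ^ 2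
      ≤ (4 * Real.pi)⁻¹ * (√(2 * Real.pi) / √t)
        * ∫ z, (∑ i ∈ F, c i * i.longitudinal a 0 z) ^ 2 := by
  have hm : MemLp (fun z => ∑ i ∈ F, c i * i.longitudinal a 0 z) 2 volume :=
    memLp_finsetSum _ fun i _ => (i.memLp_longitudinal (by simpa using i.s_pos)).const_mul _
  -- The heat kernel representation, up to the normalizing constant of `gauss`.
  have hrep : (2 * √Real.pi) * ∑ i ∈ F, c i * i.longitudinal a t x
      = Real.exp ((E1 a - freq a n ^ 2) * t) *
        ∫ z, (∑ i ∈ F, c i * i.longitudinal a 0 z) * gauss t (z - x) := by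
    have hint : ∀ i ∈ F, Integrable fun z => c i * i.longitudinal a 0 z * gauss t (z - x) :=
      fun i _ => ((i.memLp_longitudinal (by simpa using i.s_pos)).const_mul _).integrable_mul
        (memLp_gauss ht x)
    simp only [Finset.sum_mul]
    rw [integral_finsetSum _ hint, Finset.mul_sum, Finset.mul_sum]
    refine Finset.sum_congr rfl fun i hi => ?_
    simp only [WavePacket.longitudinal, hF i hi, mul_zero, Real.exp_zero, one_mul, add_zero,
      mul_assoc (c i), integral_const_mul]
    rw [integral_gauss_mul_gauss i.s_pos ht]
    ring
  have hexp : Real.exp ((E1 a - freq a n ^ 2) * t) ≤ 1 := by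
    rw [Real.exp_le_one_iff]
    exact mul_nonpos_of_nonpos_of_nonneg (sub_nonpos.2 (E1_le_freq_sq ha n)) ht.le
  have hcs := sq_integral_mul_le hm (memLp_gauss ht x)
  rw [integral_gauss_sq ht] at hcs
  have h1 : (4 * Real.pi) * (∑ i ∈ F, c i * i.longitudinal a t x) ^ 2
      = ((2 * √Real.pi) * ∑ i ∈ F, c i * i.longitudinal a t x) ^ 2 := by
    rw [mul_pow, mul_pow, Real.sq_sqrt Real.pi_pos.le]
    norm_num
  have h2 : (4 * Real.pi) * (∑ i ∈ F, c i * i.longitudinal a t x) ^ 2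
      ≤ (∫ z, (∑ i ∈ F, c i * i.longitudinal a 0 z) ^ 2) * (√(2 * Real.pi) / √t) := by
    rw [h1, hrep, mul_pow]
    refine le_trans ?_ hcs
    exact mul_le_of_le_one_left (sq_nonneg _) (pow_le_one₀ (Real.exp_pos _).le hexp)
  rw [mul_assoc, inv_mul_eq_div, le_div_iff₀ (by positivity)]
  linarith

/-- The smoothing estimate from `L²(Ω)` to `L²(Ω, K⁻¹)` for finite sums of wave packets. -/
theorem integral_weight_inv_mul_sq_le {a : ℝ} (ha : 0 < a) (F : Finset WavePacket)
    (c : WavePacket → ℝ) {t : ℝ} (ht : 0 < t) :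
    ∫ x, (weight x)⁻¹ * (∑ i ∈ F, c i * i.profile a t x) ^ 2 ∂stripMeasure a
      ≤ decayConst / √t * ∫ x, (∑ i ∈ F, c i * i.profile a 0 x) ^ 2 ∂stripMeasure a := by
  -- Group the packets by their mode.
  let N := F.image WavePacket.n
  let Φ : ℕ → Finset WavePacket := fun n => F.filter fun i => i.n = n
  let g : ℝ → ℕ → ℝ → ℝ := fun t n x => ∑ i ∈ Φ n, c i * i.longitudinal a t x
  have hsum : ∀ (t : ℝ) (x : ℝ × ℝ), ∑ i ∈ F, c i * i.profile a t x
      = ∑ n ∈ N, g t n x.1 * mode a n x.2 := by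
    intro t x
    rw [← Finset.sum_fiberwise_of_maps_to (g := WavePacket.n) (t := N)
      fun i hi => Finset.mem_image_of_mem _ hi]
    refine Finset.sum_congr rfl fun n _ => ?_
    rw [Finset.sum_mul]
    refine Finset.sum_congr rfl fun i hi => ?_
    rw [WavePacket.profile, (Finset.mem_filter.1 hi).2, mul_assoc]
  have hg : ∀ t, 0 ≤ t → ∀ n, MemLp (g t n) 2 volume := fun t ht n =>
    memLp_finsetSum _ fun i _ =>
      (i.memLp_longitudinal (add_pos_of_pos_of_nonneg i.s_pos ht)).const_mul _
  have hgg : ∀ t, 0 ≤ t → ∀ n m, Integrable fun x => g t n x * g t m x := fun t ht n m =>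
    (hg t ht n).integrable_mul (hg t ht m)
  have hwc : Continuous fun x : ℝ => Real.exp (-(1 / 4) * x ^ 2) := by fun_prop
  have hw1 : ∀ x : ℝ, ‖Real.exp (-(1 / 4) * x ^ 2)‖ ≤ 1 := fun x => by
    rw [Real.norm_of_nonneg (Real.exp_pos _).le, Real.exp_le_one_iff]
    nlinarith [sq_nonneg x]
  have hwg : ∀ n m, Integrable fun x => Real.exp (-(1 / 4) * x ^ 2) * (g t n x * g t m x) :=
    fun n m => (hgg t ht.le n m).bdd_mul hwc.aestronglyMeasurable (Eventually.of_forall hw1)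
  have hweight : ∀ x : ℝ × ℝ, (weight x)⁻¹ = Real.exp (-(1 / 4) * x.1 ^ 2) := fun x => by
    rw [weight, ← Real.exp_neg]
    congr 1
    ring
  have e1 := integral_sq_sum_modes ha N (fun x => Real.exp (-(1 / 4) * x ^ 2)) (g t) hwg
  have e2 := integral_sq_sum_modes ha N (fun _ => 1) (g 0) (by simpa using hgg 0 le_rfl)
  simp only [one_mul] at e2
  simp only [hsum, hweight]
  rw [e1, e2, mul_left_comm]
  refine mul_le_mul_of_nonneg_left ?_ ha.le
  rw [Finset.mul_sum]
  refine Finset.sum_le_sum fun n _ => ?_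
  have hI := integrable_exp_neg_mul_sq (b := 1 / 4) (by norm_num)
  calc ∫ x, Real.exp (-(1 / 4) * x ^ 2) * g t n x ^ 2
      ≤ ∫ x, Real.exp (-(1 / 4) * x ^ 2)
          * ((4 * Real.pi)⁻¹ * (√(2 * Real.pi) / √t) * ∫ z, g 0 n z ^ 2) := by
        refine integral_mono (by simpa only [sq] using hwg n n) (hI.mul_const _) fun x => ?_
        exact mul_le_mul_of_nonneg_left (sq_sum_longitudinal_le ha (Φ n) c
          (fun i hi => (Finset.mem_filter.1 hi).2) ht x) (Real.exp_pos _).le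
    _ = decayConst / √t * ∫ z, g 0 n z ^ 2 := by
        rw [integral_mul_const, decayConst]
        ring

/-- The decay estimate by duality: on the dense span of wave packets, `⟪S₀ u, f⟫ = ⟪u, S₀ f⟫` pairs
`L²(Ω, K)` with `L²(Ω, K⁻¹)`. -/
theorem norm_S0_inclusion_le {a : ℝ} (ha : 0 < a) {t : ℝ} (ht : 0 < t) (u : L2K a) :
    ‖S0 a t (inclusion a u)‖ ≤ √(decayConst / √t) * ‖u‖ := by
  have hC : 0 ≤ decayConst / √t := div_nonneg decayConst_nonneg (Real.sqrt_nonneg _)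
  have h1 : ∀ f ∈ Submodule.span ℝ (range fun i => WavePacket.curve a i 0),
      inner ℝ (S0 a t (inclusion a u)) f ≤ √(decayConst / √t) * ‖u‖ * ‖f‖ := by
    intro f hf
    obtain ⟨c, rfl⟩ := (Finsupp.mem_span_range_iff_exists_finsupp).1 hf
    have hae : ∀ τ, 0 ≤ τ → (∑ i ∈ c.support, c i • WavePacket.curve a i τ : L2 a)
        =ᵐ[stripMeasure a] fun x => ∑ i ∈ c.support, c i * i.profile a τ x := by
      intro τ hτ
      have h : ∀ i ∈ c.support, (c i • WavePacket.curve a i τ : L2 a) =ᵐ[stripMeasure a]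
          fun x => c i * i.profile a τ x := fun i _ => by
        filter_upwards [Lp.coeFn_smul (c i) (WavePacket.curve a i τ),
          i.curve_ae_eq (a := a) (add_pos_of_pos_of_nonneg i.s_pos hτ)] with x h1 h2
        rw [h1, Pi.smul_apply, h2, smul_eq_mul]
      filter_upwards [Lp.coeFn_finsetSum c.support fun i => c i • WavePacket.curve a i τ,
        (eventually_all_finset _).2 h] with x h1 h2
      rw [h1, Finset.sum_apply]
      exact Finset.sum_congr rfl h2
    have hinner : inner ℝ (S0 a t (inclusion a u)) (c.sum fun i r => r • WavePacket.curve a i 0)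
        = inner ℝ (inclusion a u) (∑ i ∈ c.support, c i • WavePacket.curve a i t) := by
      simp only [Finsupp.sum, inner_sum, real_inner_smul_right, inner_S0_curve ha _ _ ht.le]
    have hcont : Continuous fun x => ∑ i ∈ c.support, c i * i.profile a t x := by
      refine continuous_finsetSum _ fun i _ => ?_
      unfold WavePacket.profile WavePacket.longitudinal gauss mode
      fun_prop
    have h2 := inner_inclusion_le u (hae t ht.le) hcont
    have h3 := integral_weight_inv_mul_sq_le ha c.support c ht
    rw [← norm_sq_eq_integral (hae 0 le_rfl)] at h3
    rw [hinner]
    refine abs_le_of_sq_le_sq' ?_ (by positivity) |>.2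
    rw [mul_pow, mul_pow, Real.sq_sqrt hC]
    calc _ ≤ _ := h2
      _ ≤ ‖u‖ ^ 2 * (decayConst / √t * ‖∑ i ∈ c.support, c i • WavePacket.curve a i 0‖ ^ 2) := by
          gcongr
      _ = _ := by rw [Finsupp.sum]; ring
  have h2 : ∀ f : L2 a, inner ℝ (S0 a t (inclusion a u)) f ≤ √(decayConst / √t) * ‖u‖ * ‖f‖ := by
    intro f
    refine (isSolutionFamily_curve ha).dense.induction h1 ?_ f
    exact isClosed_le (by fun_prop) (by fun_prop)
  have h3 := h2 (S0 a t (inclusion a u))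
  rw [real_inner_self_eq_norm_sq, sq] at h3
  by_cases h0 : ‖S0 a t (inclusion a u)‖ = 0
  · rw [h0]; positivity
  · exact le_of_mul_le_mul_right h3 (lt_of_le_of_ne (norm_nonneg _) (Ne.symm h0))

/-! ### The lower bound -/

/-- The product of the first mode with the Gaussian `exp (-x₁² / 4)`, an element of `L²(Ω, K)`. -/
def groundPacket : WavePacket := ⟨0, 1, one_pos, 0⟩

theorem memLp_groundPacket (a : ℝ) : MemLp (groundPacket.profile a 0) 2 (weightedMeasure a) := by
  have hc : Continuous (groundPacket.profile a 0) := by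
    unfold WavePacket.profile WavePacket.longitudinal gauss mode
    fun_prop
  rw [memLp_two_iff_integrable_sq hc.aestronglyMeasurable, integrable_weightedMeasure_iff]
  have h := (memLp_tensor (a := a) (memLp_exp_neg_sq (b := 8) (by norm_num) 0)
    (contDiff_mode a 0).continuous).integrable_sq
  refine h.congr (Eventually.of_forall fun x => ?_)
  have h1 : weight x * Real.exp (-x.1 ^ 2 / 4) ^ 2 = Real.exp (-x.1 ^ 2 / 8) ^ 2 := by
    rw [weight, ← Real.exp_nat_mul, ← Real.exp_nat_mul, ← Real.exp_add]
    congr 1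
    push_cast
    ring
  simp only [WavePacket.profile, WavePacket.longitudinal, groundPacket, gauss, mul_zero,
    Real.exp_zero, add_zero, Real.sqrt_one, inv_one, one_mul, sub_zero, mul_one]
  rw [mul_pow, mul_pow, ← mul_assoc, h1]

theorem sqrt_div_sqrt_eq {c t : ℝ} (ht : 0 ≤ t) : √(c / √t) = √c * t ^ (-(1 / 4) : ℝ) := by
  rw [Real.sqrt_div' _ (Real.sqrt_nonneg t), Real.sqrt_eq_rpow (√t), Real.sqrt_eq_rpow t,
    ← Real.rpow_mul ht, Real.rpow_neg ht, div_eq_mul_inv]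
  norm_num

theorem exists_lower_bound {a : ℝ} (ha : 0 < a) :
    ∃ N : ℝ, 0 < N ∧ ∀ t, 1 ≤ t → N * t ^ (-(1 / 4) : ℝ) ≤ weightedNormS0 a t := by
  let u : L2K a := (memLp_groundPacket a).toLp
  have hu : inclusion a u = WavePacket.curve a groundPacket 0 := by
    refine Lp.ext ?_
    filter_upwards [inclusion_ae_eq u, ae_of_ae_weighted (memLp_groundPacket a).coeFn_toLp,
      groundPacket.curve_ae_eq (a := a) (t := 0) (by simp [groundPacket])] with x h1 h2 h3
    rw [h1, h2, h3]
  have key : ∀ t, 1 ≤ t →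
      √(a * √Real.pi) * t ^ (-(1 / 4) : ℝ) ≤ weightedNormS0 a t * ‖u‖ := by
    intro t ht
    have ht0 : 0 < t := one_pos.trans_le ht
    have h1 := ((S0 a t).comp (inclusion a)).le_opNorm u
    rw [ContinuousLinearMap.comp_apply, hu, S0_curve ha _ ht0.le] at h1
    refine le_trans ?_ h1
    rw [← sqrt_div_sqrt_eq ht0.le]
    refine Real.sqrt_le_iff.2 ⟨norm_nonneg _, ?_⟩
    rw [norm_sq_curve_ground ha _ rfl (by simp only [groundPacket]; positivity), mul_div_assoc]
    gcongr a * ?_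
    rw [div_le_div_iff₀ (Real.sqrt_pos.2 ht0)
      (Real.sqrt_pos.2 (by simp only [groundPacket]; positivity)),
      ← Real.sqrt_mul Real.pi_pos.le, ← Real.sqrt_mul (by positivity)]
    refine Real.sqrt_le_sqrt ?_
    simp only [groundPacket]
    nlinarith [Real.pi_pos]
  have hpos : 0 < √(a * √Real.pi) := by positivity
  have hu0 : 0 < ‖u‖ := by
    refine lt_of_le_of_ne (norm_nonneg _) fun h => ?_
    have := key 1 le_rfl
    rw [← h, mul_zero, Real.one_rpow, mul_one] at this
    linarith
  refine ⟨√(a * √Real.pi) / ‖u‖, by positivity, fun t ht => ?_⟩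
  rw [div_mul_eq_mul_div, div_le_iff₀ hu0]
  exact key t ht

theorem weightedNormS0_le {a : ℝ} (ha : 0 < a) {t : ℝ} (ht : 0 < t) :
    weightedNormS0 a t ≤ √decayConst * t ^ (-(1 / 4) : ℝ) := by
  rw [← sqrt_div_sqrt_eq ht.le]
  exact ContinuousLinearMap.opNorm_le_bound _ (Real.sqrt_nonneg _) fun u =>
    norm_S0_inclusion_le ha ht u

end UntwistedStrip

end

theorem mainTheorem6 (a : ℝ) (ha : 0 < a) :
    UntwistedStrip.IsSemigroupGeneratedBy
      (UntwistedStrip.shiftedLaplacianGraph a) (UntwistedStrip.S0 a) ∧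
    ∃ C : ℝ, 0 < C ∧ ∀ t : ℝ, 1 ≤ t →
      C⁻¹ * t ^ (-(1 / 4) : ℝ) ≤ UntwistedStrip.weightedNormS0 a t ∧
      UntwistedStrip.weightedNormS0 a t ≤ C * t ^ (-(1 / 4) : ℝ) := by
  refine ⟨UntwistedStrip.isSemigroupGeneratedBy_S0 ha, ?_⟩
  obtain ⟨N, hN, hlow⟩ := UntwistedStrip.exists_lower_bound ha
  have hs := Real.sqrt_nonneg UntwistedStrip.decayConst
  have hNinv := inv_pos.2 hN
  refine ⟨√UntwistedStrip.decayConst + N⁻¹, by positivity, fun t ht => ⟨?_, ?_⟩⟩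
  · refine le_trans ?_ (hlow t ht)
    gcongr
    exact inv_le_of_inv_le₀ hN (le_add_of_nonneg_left hs)
  · refine (UntwistedStrip.weightedNormS0_le ha (one_pos.trans_le ht)).trans ?_
    gcongr
    exact le_add_of_nonneg_right hNinv.le
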